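/- Let $d\ge 1$ be an integer, let $\gamma_1,\gamma_2,\gamma_3>0$, and let $1\le p<\frac{d+2}{d}$. For $r>0$ let $B_r(x_0)$ be the open Euclidean ball in $\mathbb{R}^d$ of radius $r$ centred at $x_0$, let $B_r=B_r(0)$, and let $Q_r=(-r^2,0)\times B_r\subset\mathbb{R}\times\mathbb{R}^d$. Write $a_+=\max(a,0)$. A function $u:Q_2\to\mathbb{R}$ belongs to the De Giorgi sub-class $DG^+(\gamma_1,\gamma_2,\gamma_3,p)$ on $Q_2$ if $u\in L^\infty((-4,0);L^2(B_2))$, its weak spatial gradient $\nabla_x u$ is in $L^2(Q_2)$, and for all $k\in\mathbb{R}$, all $0<r<R$, all $x_0\in B_2$ with $B_R(x_0)\subset B_2$, and almost all times $s<t$ in $(-4,0)$, $$\int_{B_r(x_0)}(u-k)_+^2(t,x)\,dx+\gamma_1\int_s^t\int_{B_r(x_0)}|\nabla_x(u-k)_+(\tau,x)|^2\,dx\,d\tau$$ $$\le\int_{B_R(x_0)}(u-k)_+^2(s,x)\,dx+\frac{\gamma_2}{(R-r)^2}\int_s^t\int_{B_R(x_0)}(u-k)_+^2(\tau,x)\,dx\,d\tau+\gamma_3\left(\int_s^t\int_{B_R(x_0)}(u-k)_+^p(\tau,x)\,dx\,d\tau\right)^{1/p}.$$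 Then the following two statements hold. 1. There is $\delta>0$, depending only on $d,\gamma_1,\gamma_2,\gamma_3$ and $p$, such that for every $u\in DG^+(\gamma_1,\gamma_2,\gamma_3,p)$ on $Q_2$: if $\int_{Q_1}u_+^2\le\delta$, then $u_+\le\frac12$ almost everywhere in $Q_{1/2}$. 2. There is $C>0$, depending only on $d,\gamma_1,\gamma_2,\gamma_3$ and $p$, such that for every $u\in DG^+(\gamma_1,\gamma_2,\gamma_3,p)$ on $Q_2$, $$\|u_+\|_{L^\infty(Q_{1/2})}\le C\left(\|u_+\|_{L^2(Q_1)}+1\right).$$ -/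

import Mathlib

open MeasureTheory Set
open scoped ContDiff ENNReal

noncomputable section

/-- The parabolic cylinder `Q_r = (-r², 0) × B_r` in time-space `ℝ × ℝ^d`, where `B_r` is the open
Euclidean ball of radius `r` centred at the origin. -/
def parabolicCylinder (d : ℕ) (r : ℝ) : Set (ℝ × EuclideanSpace ℝ (Fin d)) :=
  Ioo (-r ^ 2) 0 ×ˢ Metric.ball 0 r

/-- `G` is the weak (distributional) gradient in the space variable of `u` on the open set `Q` of
time-space, and it is in `L²(Q)`:
`∫_Q u ∂_v φ = - ∫_Q (G · v) φ` for every `φ ∈ C_c^∞(Q)` and every direction `v` in space. -/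
structure HasL2SpatialGradient {d : ℕ} (Q : Set (ℝ × EuclideanSpace ℝ (Fin d)))
    (u : ℝ × EuclideanSpace ℝ (Fin d) → ℝ)
    (G : ℝ × EuclideanSpace ℝ (Fin d) → EuclideanSpace ℝ (Fin d)) : Prop where
  memLp : MemLp G 2 (volume.restrict Q)
  integral_eq : ∀ φ : ℝ × EuclideanSpace ℝ (Fin d) → ℝ,
    ContDiff ℝ ∞ φ → HasCompactSupport φ → tsupport φ ⊆ Q →
    ∀ v : EuclideanSpace ℝ (Fin d),
      ∫ z in Q, u z * fderiv ℝ φ z (0, v) = - ∫ z in Q, inner ℝ (G z) v * φ z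

/-- `u ∈ L^∞((T₁, T₂); L²(Ω))`, for a function `u` of `(t, x)`. -/
structure MemLinftyL2 {d : ℕ} (T₁ T₂ : ℝ) (Ω : Set (EuclideanSpace ℝ (Fin d)))
    (u : ℝ × EuclideanSpace ℝ (Fin d) → ℝ) : Prop where
  aestronglyMeasurable : AEStronglyMeasurable u (volume.restrict (Ioo T₁ T₂ ×ˢ Ω))
  bounded : ∃ M : ℝ, ∀ᵐ t ∂(volume.restrict (Ioo T₁ T₂)),
    eLpNorm (fun x => u (t, x)) 2 (volume.restrict Ω) ≤ ENNReal.ofReal M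

/-- The energy inequality of the De Giorgi sub-class, for the level `k`, the balls
`B_r(x₀) ⊆ B_R(x₀)` and the times `s < t`; `G` stands for `∇ₓ (u - k)₊`. All the integrands are
nonnegative and the integrals are taken in `[0, ∞]`. -/
def EnergyInequality {d : ℕ} (γ₁ γ₂ γ₃ p : ℝ) (u : ℝ × EuclideanSpace ℝ (Fin d) → ℝ)
    (k : ℝ) (G : ℝ × EuclideanSpace ℝ (Fin d) → EuclideanSpace ℝ (Fin d))
    (x₀ : EuclideanSpace ℝ (Fin d)) (r R s t : ℝ) : Prop :=
  (∫⁻ x in Metric.ball x₀ r, ENNReal.ofReal (max (u (t, x) - k) 0 ^ 2))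
    + ENNReal.ofReal γ₁ *
      (∫⁻ τ in Ioo s t, ∫⁻ x in Metric.ball x₀ r, ENNReal.ofReal (‖G (τ, x)‖ ^ 2))
  ≤ (∫⁻ x in Metric.ball x₀ R, ENNReal.ofReal (max (u (s, x) - k) 0 ^ 2))
    + ENNReal.ofReal (γ₂ / (R - r) ^ 2) *
      (∫⁻ τ in Ioo s t, ∫⁻ x in Metric.ball x₀ R, ENNReal.ofReal (max (u (τ, x) - k) 0 ^ 2))
    + ENNReal.ofReal γ₃ *
      (∫⁻ τ in Ioo s t, ∫⁻ x in Metric.ball x₀ R,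
        ENNReal.ofReal (max (u (τ, x) - k) 0 ^ p)) ^ (1 / p)

/-- The parabolic De Giorgi sub-class `DG⁺(γ₁, γ₂, γ₃, p)` on `(T₁, T₂) × Ω`.

A function in `L^∞((T₁, T₂); L²(Ω))` has values at almost every time only, so the energy
inequality is required at almost all times `s < t`; the class then depends only on `u` up to
null sets, and it contains every `u` satisfying the inequality at all times `s < t`.
The weak gradient of `(u - k)₊` is unique up to null sets, and it exists in `L²` because `∇ₓ u`
does (it is `∇ₓ u` on `{u > k}` and `0` elsewhere), so `∃ G` only gives it a name. -/
structure DeGiorgiSubclass {d : ℕ} (T₁ T₂ : ℝ) (Ω : Set (EuclideanSpace ℝ (Fin d)))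
    (γ₁ γ₂ γ₃ p : ℝ) (u : ℝ × EuclideanSpace ℝ (Fin d) → ℝ) : Prop where
  memLinftyL2 : MemLinftyL2 T₁ T₂ Ω u
  exists_gradient : ∃ G, HasL2SpatialGradient (Ioo T₁ T₂ ×ˢ Ω) u G
  energy : ∀ k : ℝ, ∃ G,
    HasL2SpatialGradient (Ioo T₁ T₂ ×ˢ Ω) (fun z => max (u z - k) 0) G ∧
    ∀ (r R : ℝ) (x₀ : EuclideanSpace ℝ (Fin d)), 0 < r → r < R → x₀ ∈ Ω →
      Metric.ball x₀ R ⊆ Ω →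
      ∀ᵐ s ∂(volume.restrict (Ioo T₁ T₂)), ∀ᵐ t ∂(volume.restrict (Ioo T₁ T₂)),
        s < t → EnergyInequality γ₁ γ₂ γ₃ p u k G x₀ r R s t

end

/-! The proof is De Giorgi's iteration. Let `E` be the energy of a truncation of `u` on a cylinder:
the supremum over time of the squared `L²` norm of a slice, together with the integral of the
squared gradient. Finite energy yields higher integrability. After raising the level by `c > 0` and
shrinking the cylinder, the `q`-th power of the truncation has integral at most a constant times `E
^ (1 + 2 / d)`, for every `q < 2 + 4 / d`. In the energy inequality the quadratic terms then
contribute `E ^ (1 + 2 / d)` and the `L^p` term contributes `E ^ ((1 + 2 / d) / p)`. Both exponents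
exceed `1` because `p < (d + 2) / d`. A superlinear recursion with geometrically growing constants
tends to zero from small initial energy, so the truncation at the limit level `1 / 2` vanishes.

The gain of integrability rests on translations. A weak gradient in `L²` bounds `w (x + y) - w x` in
`L²` by `‖y‖`. Averaging over `y` in a ball much larger than the support of each time slice gives a
local Faber–Krahn inequality. Chebyshev's inequality bounds these supports for superlevel sets, and
a sum over dyadic levels gives all powers below `2 + 4 / d`.

Starting the iteration takes two steps, since for `p > 2` (possible when `d = 1`) a small `L²` norm
does not control the `L^p` term directly. The `L^p` term is of order `√E`, so absorption over a
sequence of radii bounds `E` by a universal constant. This bound makes the high part of `u` small in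
`L^p`, and the small `L²` norm handles the rest.

The second statement follows by scaling: the class is stable under multiplication by `c ≤ 1`.

The intermediate cylinders are `(-ρ, 0) × B_ρ`, so that the gaps in time and in space are the same
number. -/

/-- Cauchy–Schwarz against the constant `1`, for lower integrals. -/
theorem sq_lintegral_le {α : Type*} [MeasurableSpace α] (μ : Measure α) {f : α → ℝ≥0∞}
    (hf : AEMeasurable f μ) : (∫⁻ a, f a ∂μ) ^ 2 ≤ μ univ * ∫⁻ a, f a ^ 2 ∂μ := by
  have h := ENNReal.lintegral_mul_le_Lp_mul_Lq μ (Real.HolderConjugate.two_two) hf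
    (aemeasurable_const (b := (1 : ℝ≥0∞)))
  simp only [Pi.mul_apply, mul_one, ENNReal.one_rpow, lintegral_const, one_mul] at h
  have h2 := ENNReal.rpow_le_rpow h (z := 2) (by norm_num)
  rw [ENNReal.mul_rpow_of_nonneg _ _ (by norm_num), ← ENNReal.rpow_mul, ← ENNReal.rpow_mul] at h2
  norm_num at h2
  rw [mul_comm]
  exact h2

theorem ofReal_sq_eq_enorm (x : ℝ) : ENNReal.ofReal (x ^ 2) = ‖x‖ₑ ^ 2 := by
  rw [← sq_abs, ENNReal.ofReal_pow (abs_nonneg x), ← Real.norm_eq_abs, ofReal_norm]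

/-! ### Weak derivatives and `L²` translation estimates. -/

section Translation

variable {Z : Type*} [NormedAddCommGroup Z] [NormedSpace ℝ Z] [FiniteDimensional ℝ Z]
  [MeasurableSpace Z] [BorelSpace Z] (μ : Measure Z) [μ.IsAddHaarMeasure]

/-- The shear `(s, z) ↦ (s, z + s η)` preserves the product measure. -/
theorem measurePreserving_shear (ν : Measure ℝ) [SFinite ν] (η : Z) :
    MeasurePreserving (fun q : ℝ × Z => (q.1, q.2 + q.1 • η)) (ν.prod μ) (ν.prod μ) := by
  refine (MeasurePreserving.id ν).skew_product (g := fun s z => z + s • η) ?_ ?_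
  · fun_prop
  · filter_upwards with s
    exact (measurePreserving_add_right μ (s • η)).map_eq

theorem integrable_shear {g : Z → ℝ} (hg : Integrable g μ) (η : Z) :
    Integrable (fun q : ℝ × Z => g (q.2 + q.1 • η)) ((volume.restrict (Ioc (0 : ℝ) 1)).prod μ) := by
  have h : Integrable (fun q : ℝ × Z => g q.2) ((volume.restrict (Ioc (0 : ℝ) 1)).prod μ) :=
    hg.comp_snd _
  exact (measurePreserving_shear μ (volume.restrict (Ioc (0 : ℝ) 1)) η).integrable_comp_of_integrable h

/-- If `g` is the weak derivative of `v` in the direction `η` along all translates by `s η`,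
`0 ≤ s ≤ 1`, of the open set `U`, then `v (z + η) - v z = ∫₀¹ g (z + s η) ds` almost everywhere
in `U`. -/
theorem translate_sub_eq_integral {v g : Z → ℝ} (hv : Integrable v μ) (hg : Integrable g μ)
    {U : Set Z} (hU : IsOpen U) (η : Z)
    (h : ∀ φ : Z → ℝ, ContDiff ℝ ∞ φ → HasCompactSupport φ → tsupport φ ⊆ U →
      ∀ s ∈ Ioc (0 : ℝ) 1, ∫ z, v z * fderiv ℝ φ (z - s • η) η ∂μ
        = - ∫ z, g z * φ (z - s • η) ∂μ) :
    ∀ᵐ z ∂μ, z ∈ U → v (z + η) - v z = ∫ s in Ioc (0 : ℝ) 1, g (z + s • η) := by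
  set ν : Measure ℝ := volume.restrict (Ioc (0 : ℝ) 1) with hν
  have hgs := integrable_shear μ hg η
  have hH : Integrable (fun z => ∫ s, g (z + s • η) ∂ν) μ := hgs.integral_prod_right
  have hvt : Integrable (fun z => v (z + η)) μ := hv.comp_add_right η
  have hD : Integrable (fun z => v (z + η) - v z - ∫ s, g (z + s • η) ∂ν) μ := (hvt.sub hv).sub hH
  -- It suffices to test the difference of the two sides against `φ` supported in `U`. Translations
  -- are moved onto `φ`, for which the fundamental theorem of calculus holds pointwise, and Fubini
  -- moves the result back onto `g`.
  have key := hU.ae_eq_zero_of_integral_contDiff_smul_eq_zero (μ := μ)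
    (f := fun z => v (z + η) - v z - ∫ s, g (z + s • η) ∂ν)
    (hD.locallyIntegrable.locallyIntegrableOn U) ?_
  · filter_upwards [key] with z hz hzU
    exact sub_eq_zero.1 (hz hzU)
  intro φ hφ hφc hφU
  obtain ⟨Cφ, hCφ⟩ := hφc.exists_bound_of_continuous hφ.continuous
  have hφ' : Continuous (fderiv ℝ φ) := hφ.continuous_fderiv (by simp)
  have hdc : HasCompactSupport (fun z => fderiv ℝ φ z η) :=
    (hφc.fderiv ℝ).comp_left (g := fun L : Z →L[ℝ] ℝ => L η) (by simp)
  have hdcont : Continuous (fun z => fderiv ℝ φ z η) := by fun_prop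
  obtain ⟨Cd, hCd⟩ := hdc.exists_bound_of_continuous hdcont
  have hbm : ∀ {f : Z → ℝ}, Integrable f μ → Integrable (fun z => φ z * f z) μ := fun hf =>
    hf.bdd_mul hφ.continuous.aestronglyMeasurable (Filter.Eventually.of_forall hCφ)
  have hvφ : Integrable (fun z => v z * φ (z - η)) μ :=
    hv.mul_bdd (c := Cφ) (Continuous.aestronglyMeasurable (by fun_prop)) (Filter.Eventually.of_forall fun z => hCφ _)
  have e1 : ∫ z, φ z * (v (z + η) - v z) ∂μ = ∫ z, v z * (φ (z - η) - φ z) ∂μ := by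
    have a : ∫ z, φ z * v (z + η) ∂μ = ∫ z, v z * φ (z - η) ∂μ := by
      rw [← integral_sub_right_eq_self (fun z => φ z * v (z + η)) η]
      simp [mul_comm]
    simp only [mul_sub]
    rw [integral_sub (hbm hvt) (hbm hv), integral_sub hvφ (by simpa [mul_comm] using hbm hv), a]
    simp [mul_comm]
  have e2 : ∀ z, φ (z - η) - φ z = - ∫ s, fderiv ℝ φ (z - s • η) η ∂ν := by
    intro z
    have hd : ∀ s ∈ uIcc (0 : ℝ) 1, HasDerivAt (fun s : ℝ => φ (z - s • η))
        (fderiv ℝ φ (z - s • η) (-η)) s := by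
      intro s _
      have h1 : HasDerivAt (fun s : ℝ => z - s • η) (-η) s := by
        simpa using ((hasDerivAt_id s).smul_const η).const_sub z
      have h2 := (hφ.differentiable (by simp) (z - s • η)).hasFDerivAt
      exact h2.comp_hasDerivAt s h1
    have := intervalIntegral.integral_eq_sub_of_hasDerivAt hd
      (Continuous.intervalIntegrable (by fun_prop) _ _)
    rw [intervalIntegral.integral_of_le zero_le_one] at this
    simp only [map_neg, integral_neg, one_smul, zero_smul, sub_zero] at this
    rw [← this]
  have e3 : ∫ z, v z * (φ (z - η) - φ z) ∂μ
      = - ∫ z, ∫ s, v z * fderiv ℝ φ (z - s • η) η ∂ν ∂μ := by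
    rw [← integral_neg]
    congr 1 with z
    rw [e2, integral_const_mul, mul_neg]
  have i3 : Integrable (Function.uncurry fun (z : Z) (s : ℝ) => v z * fderiv ℝ φ (z - s • η) η)
      (μ.prod ν) := by
    refine (hv.comp_fst ν).mul_bdd (c := Cd) ?_ (Filter.Eventually.of_forall fun q => hCd _)
    exact Continuous.aestronglyMeasurable (by fun_prop)
  have e4 : ∫ z, ∫ s, v z * fderiv ℝ φ (z - s • η) η ∂ν ∂μ
      = - ∫ s, ∫ z, φ z * g (z + s • η) ∂μ ∂ν := by
    rw [integral_integral_swap i3, ← integral_neg]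
    refine integral_congr_ae ?_
    filter_upwards [ae_restrict_mem measurableSet_Ioc] with s hs
    rw [h φ hφ hφc hφU s hs, ← integral_add_right_eq_self (fun z => g z * φ (z - s • η)) (s • η)]
    simp [mul_comm]
  have i5 : Integrable (Function.uncurry fun (s : ℝ) (z : Z) => φ z * g (z + s • η))
      (ν.prod μ) := by
    refine hgs.bdd_mul (c := Cφ) ?_ (Filter.Eventually.of_forall fun q => hCφ _)
    exact Continuous.aestronglyMeasurable (by fun_prop)
  simp only [smul_eq_mul, mul_sub (φ _) (v _ - v _)]
  have hvd : Integrable (fun z => v (z + η) - v z) μ := hvt.sub hv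
  rw [integral_sub (hbm hvd) (hbm hH), e1, e3, e4, integral_integral_swap i5, neg_neg]
  simp only [integral_const_mul, sub_self]

/-- Cauchy–Schwarz on the unit interval, applied to the integral representation of the increment,
followed by Tonelli and the translation invariance of `μ`. -/
theorem lintegral_sq_translate_sub_le {v g : Z → ℝ} (hv : Integrable v μ) (hg : Integrable g μ)
    {U : Set Z} (hU : IsOpen U) (η : Z)
    (h : ∀ φ : Z → ℝ, ContDiff ℝ ∞ φ → HasCompactSupport φ → tsupport φ ⊆ U →
      ∀ s ∈ Ioc (0 : ℝ) 1, ∫ z, v z * fderiv ℝ φ (z - s • η) η ∂μ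
        = - ∫ z, g z * φ (z - s • η) ∂μ) :
    ∫⁻ z in U, ENNReal.ofReal ((v (z + η) - v z) ^ 2) ∂μ
      ≤ ∫⁻ z, ENNReal.ofReal (g z ^ 2) ∂μ := by
  set ν : Measure ℝ := volume.restrict (Ioc (0 : ℝ) 1) with hν
  have hgs := integrable_shear μ hg η
  have hm : AEMeasurable (fun q : ℝ × Z => ‖g (q.2 + q.1 • η)‖ₑ ^ 2) (ν.prod μ) :=
    hgs.aestronglyMeasurable.enorm.pow_const 2
  calc ∫⁻ z in U, ENNReal.ofReal ((v (z + η) - v z) ^ 2) ∂μ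
      ≤ ∫⁻ z in U, (∫⁻ s, ‖g (z + s • η)‖ₑ ^ 2 ∂ν) ∂μ := by
        refine lintegral_mono_ae ?_
        have hsec : ∀ᵐ z ∂μ, Integrable (fun s => g (z + s • η)) ν := hgs.prod_left_ae
        rw [ae_restrict_iff' hU.measurableSet]
        filter_upwards [translate_sub_eq_integral μ hv hg hU η h, hsec] with z hz hzi hzU
        rw [hz hzU, ofReal_sq_eq_enorm]
        calc ‖∫ s, g (z + s • η) ∂ν‖ₑ ^ 2 ≤ (∫⁻ s, ‖g (z + s • η)‖ₑ ∂ν) ^ 2 := by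
              gcongr; exact enorm_integral_le_lintegral_enorm _
          _ ≤ ν univ * ∫⁻ s, ‖g (z + s • η)‖ₑ ^ 2 ∂ν :=
              sq_lintegral_le ν hzi.aestronglyMeasurable.enorm
          _ = _ := by simp [hν]
    _ ≤ ∫⁻ z, (∫⁻ s, ‖g (z + s • η)‖ₑ ^ 2 ∂ν) ∂μ := setLIntegral_le_lintegral _ _
    _ = ∫⁻ s, (∫⁻ z, ‖g (z + s • η)‖ₑ ^ 2 ∂μ) ∂ν := by
        rw [lintegral_lintegral_swap]
        exact hm.prod_swap
    _ = ∫⁻ s, (∫⁻ z, ‖g z‖ₑ ^ 2 ∂μ) ∂ν := by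
        congr 1 with s
        exact lintegral_add_right_eq_self (fun z => ‖g z‖ₑ ^ 2) (s • η)
    _ = _ := by simp [hν, ofReal_sq_eq_enorm]

end Translation

theorem HasL2SpatialGradient.mono {d : ℕ} {Q Q' : Set (ℝ × EuclideanSpace ℝ (Fin d))}
    {u : ℝ × EuclideanSpace ℝ (Fin d) → ℝ}
    {G : ℝ × EuclideanSpace ℝ (Fin d) → EuclideanSpace ℝ (Fin d)}
    (h : HasL2SpatialGradient Q u G) (hQm : MeasurableSet Q) (hQ : Q' ⊆ Q) :
    HasL2SpatialGradient Q' u G := by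
  refine ⟨h.memLp.mono_measure (Measure.restrict_mono hQ le_rfl), fun φ hφ hφc hφQ v => ?_⟩
  have h1 := h.integral_eq φ hφ hφc (hφQ.trans hQ) v
  have hz : ∀ z, z ∉ Q' → φ z = 0 := fun z hz => image_eq_zero_of_notMem_tsupport fun hz' => hz (hφQ hz')
  have hz' : ∀ z, z ∉ Q' → fderiv ℝ φ z = 0 := fun z hz =>
    image_eq_zero_of_notMem_tsupport fun hz' => hz (hφQ (tsupport_fderiv_subset ℝ hz'))
  rw [← setIntegral_eq_of_subset_of_forall_sdiff_eq_zero hQm hQ, h1,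
    ← setIntegral_eq_of_subset_of_forall_sdiff_eq_zero hQm hQ]
  · exact fun z hzz => by simp [hz z hzz.2]
  · exact fun z hzz => by simp [hz' z hzz.2]

/-- A function with a spatial gradient in `L²` satisfies the translation estimate in space. -/
theorem HasL2SpatialGradient.lintegral_sq_translate_sub_le {d : ℕ} {a b r R : ℝ}
    {v : ℝ × EuclideanSpace ℝ (Fin d) → ℝ}
    {G : ℝ × EuclideanSpace ℝ (Fin d) → EuclideanSpace ℝ (Fin d)}
    (h : HasL2SpatialGradient (Ioo a b ×ˢ Metric.ball 0 R) v G)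
    (hv : IntegrableOn v (Ioo a b ×ˢ Metric.ball 0 R))
    {y : EuclideanSpace ℝ (Fin d)} (hy : r + ‖y‖ ≤ R) :
    ∫⁻ z in Ioo a b ×ˢ Metric.ball 0 r, ENNReal.ofReal ((v (z.1, z.2 + y) - v z) ^ 2)
      ≤ ENNReal.ofReal (‖y‖ ^ 2) *
        ∫⁻ z in Ioo a b ×ˢ Metric.ball 0 R, ENNReal.ofReal (‖G z‖ ^ 2) := by
  set Q : Set (ℝ × EuclideanSpace ℝ (Fin d)) := Ioo a b ×ˢ Metric.ball 0 R with hQdef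
  set U : Set (ℝ × EuclideanSpace ℝ (Fin d)) := Ioo a b ×ˢ Metric.ball 0 r with hUdef
  set η : ℝ × EuclideanSpace ℝ (Fin d) := (0, y) with hη
  have hQo : IsOpen Q := isOpen_Ioo.prod Metric.isOpen_ball
  have hUo : IsOpen U := isOpen_Ioo.prod Metric.isOpen_ball
  have hQm := hQo.measurableSet
  have hQfin : volume Q < ⊤ := by
    rw [hQdef, Measure.volume_eq_prod, Measure.prod_prod]
    exact ENNReal.mul_lt_top measure_Ioo_lt_top measure_ball_lt_top
  have : IsFiniteMeasure (volume.restrict Q) := ⟨by simpa using hQfin⟩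
  have hG1 : Integrable G (volume.restrict Q) := h.memLp.integrable (by norm_num)
  have hGy : IntegrableOn (fun z => inner ℝ (G z) y) Q := hG1.inner_const y
  have hshift : ∀ s ∈ Icc (0 : ℝ) 1, ∀ z ∈ U, z + s • η ∈ Q := by
    rintro s ⟨hs0, hs1⟩ ⟨t, x⟩ ⟨ht, hx⟩
    refine ⟨by simpa [hη] using ht, ?_⟩
    simp only [hη, Prod.smul_mk, Prod.mk_add_mk, mem_ball_zero_iff] at hx ⊢
    calc ‖x + s • y‖ ≤ ‖x‖ + ‖s • y‖ := norm_add_le _ _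
      _ ≤ ‖x‖ + 1 * ‖y‖ := by
          rw [norm_smul, Real.norm_eq_abs, abs_of_nonneg hs0]; gcongr
      _ < R := by linarith
  have : (volume : Measure (ℝ × EuclideanSpace ℝ (Fin d))).IsAddHaarMeasure :=
    inferInstanceAs ((volume : Measure ℝ).prod volume).IsAddHaarMeasure
  -- Both functions are extended by zero. The extension need not be weakly differentiable across the
  -- boundary of `Q`, but only test functions supported in `U` enter, and their translates stay
  -- supported in `Q`.
  have key := _root_.lintegral_sq_translate_sub_le (volume : Measure (ℝ × EuclideanSpace ℝ (Fin d)))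
    (v := Q.indicator v) (g := Q.indicator fun z => inner ℝ (G z) y)
    (hv.integrable_indicator hQm) (hGy.integrable_indicator hQm) hUo η ?_
  · calc ∫⁻ z in U, ENNReal.ofReal ((v (z.1, z.2 + y) - v z) ^ 2)
        = ∫⁻ z in U, ENNReal.ofReal ((Q.indicator v (z + η) - Q.indicator v z) ^ 2) := by
          refine setLIntegral_congr_fun hUo.measurableSet fun z hz => ?_
          have h0 := hshift 0 (by simp) z hz
          have h1 := hshift 1 (by simp) z hz
          simp only [zero_smul, add_zero, one_smul] at h0 h1
          have e : z + η = (z.1, z.2 + y) := by ext <;> simp [hη]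
          rw [indicator_of_mem h1, indicator_of_mem h0, e]
      _ ≤ _ := key
      _ ≤ ∫⁻ z, Q.indicator (fun z => ENNReal.ofReal (‖y‖ ^ 2) * ENNReal.ofReal (‖G z‖ ^ 2)) z := by
          refine lintegral_mono fun z => ?_
          by_cases hz : z ∈ Q
          · simp only [indicator_of_mem hz]
            rw [← ENNReal.ofReal_mul (by positivity)]
            refine ENNReal.ofReal_le_ofReal ?_
            rw [← mul_pow, mul_comm, ← sq_abs]
            gcongr
            exact abs_real_inner_le_norm _ _
          · simp [indicator_of_notMem hz]
      _ = _ := by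
          rw [lintegral_indicator hQm, lintegral_const_mul' _ _ ENNReal.ofReal_ne_top]
  · intro φ hφ hφc hφU s hs
    have hs' : s ∈ Icc (0 : ℝ) 1 := ⟨hs.1.le, hs.2⟩
    have hfd : ∀ z, fderiv ℝ (fun z => φ (z - s • η)) z = fderiv ℝ φ (z - s • η) := fun z => by
      simp only [sub_eq_add_neg]
      exact fderiv_comp_add_right (-(s • η))
    have h1 := h.integral_eq (fun z => φ (z - s • η)) (by fun_prop)
      (hφc.comp_homeomorph (Homeomorph.subRight (s • η))) ?_ y
    · simp only [hfd] at h1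
      rw [← integral_indicator hQm, ← integral_indicator hQm] at h1
      have eL : (fun z => Q.indicator v z * fderiv ℝ φ (z - s • η) η)
          = Q.indicator (fun z => v z * fderiv ℝ φ (z - s • η) (0, y)) := by
        ext z; by_cases hz : z ∈ Q <;> simp [hz, hη]
      have eR : (fun z => Q.indicator (fun z => inner ℝ (G z) y) z * φ (z - s • η))
          = Q.indicator (fun z => inner ℝ (G z) y * φ (z - s • η)) := by
        ext z; by_cases hz : z ∈ Q <;> simp [hz]
      rw [eL, eR]
      exact h1
    · have := tsupport_comp_subset_preimage φ (f := fun z => z - s • η) (by fun_prop)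
      refine this.trans fun z hz => ?_
      simpa using hshift s hs' _ (hφU hz)

/-! ### A local Faber–Krahn inequality. -/

section DeGiorgi

variable {d : ℕ}

local notation "𝔼" => EuclideanSpace ℝ (Fin d)

/-- The two sides differ by `y ^ 2`. The product on the right is the term that a small support makes
small after averaging. -/
theorem ofReal_sq_le_add_two_mul {x y : ℝ} (hx : 0 ≤ x) (hy : 0 ≤ y) :
    ENNReal.ofReal (x ^ 2) ≤
      ENNReal.ofReal ((y - x) ^ 2) + 2 * (ENNReal.ofReal x * ENNReal.ofReal y) := by
  rw [← ENNReal.ofReal_mul hx, ← ENNReal.ofReal_ofNat, ← ENNReal.ofReal_mul (by norm_num),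
    ← ENNReal.ofReal_add (by positivity) (by positivity)]
  exact ENNReal.ofReal_le_ofReal (by nlinarith [sq_nonneg y])

/-- One step of the local Faber–Krahn inequality: averaging `w² ≤ (w - w_y)² + 2 w w_y` over `y` in a
ball of radius `h`. -/
theorem lintegral_sq_le_of_translate {a b r h R s : ℝ} {g : ℝ≥0∞}
    {w : ℝ × 𝔼 → ℝ} (hw : Measurable w) (hw0 : ∀ z, 0 ≤ w z)
    (hD : ∀ y : 𝔼, r + ‖y‖ ≤ R →
      ∫⁻ z in Ioo a b ×ˢ Metric.ball 0 r, ENNReal.ofReal ((w (z.1, z.2 + y) - w z) ^ 2)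
        ≤ ENNReal.ofReal (‖y‖ ^ 2) * g)
    (hS : ∀ᵐ t ∂(volume.restrict (Ioo a b)),
      volume {x | x ∈ Metric.ball (0 : 𝔼) R ∧ w (t, x) ≠ 0} ≤
        ENNReal.ofReal s)
    (hh : 0 < h) (hrh : r + h ≤ R)
    (hs : 8 * ENNReal.ofReal s ≤ volume (Metric.ball (0 : 𝔼) h)) :
    ∫⁻ z in Ioo a b ×ˢ Metric.ball 0 r, ENNReal.ofReal (w z ^ 2)
      ≤ ENNReal.ofReal (h ^ 2) * g +
        4⁻¹ * ∫⁻ z in Ioo a b ×ˢ Metric.ball 0 (r + h), ENNReal.ofReal (w z ^ 2) := by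
  set W : ℝ × 𝔼 → ℝ≥0∞ := fun z => ENNReal.ofReal (w z) with hW
  have hWm : Measurable W := hw.ennreal_ofReal
  set U : Set (ℝ × 𝔼) := Ioo a b ×ˢ Metric.ball 0 r
  have hWsq : ∀ z, ENNReal.ofReal (w z ^ 2) = W z ^ 2 := fun z => ENNReal.ofReal_pow (hw0 z) 2
  set A : ℝ≥0∞ := ∫⁻ z in U, ENNReal.ofReal (w z ^ 2) with hA
  set A' : ℝ≥0∞ := ∫⁻ z in Ioo a b ×ˢ Metric.ball 0 (r + h), ENNReal.ofReal (w z ^ 2) with hA'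
  set V : ℝ≥0∞ := volume (Metric.ball (0 : 𝔼) h) with hV
  have hVtop : V ≠ ⊤ := measure_ball_lt_top.ne
  have hV0 : V ≠ 0 := (Metric.measure_ball_pos volume _ hh).ne'
  have hsub : Metric.ball (0 : 𝔼) (r + h) ⊆ Metric.ball 0 R := Metric.ball_subset_ball hrh
  have hWy : Measurable (fun q : 𝔼 × (ℝ × 𝔼) => W (q.2.1, q.2.2 + q.1)) := by fun_prop
  have step : ∀ y ∈ Metric.ball (0 : 𝔼) h,
      A ≤ ENNReal.ofReal (h ^ 2) * g + 2 * ∫⁻ z in U, W z * W (z.1, z.2 + y) := by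
    intro y hy
    have hy' : ‖y‖ < h := by simpa using hy
    calc A ≤ ∫⁻ z in U, (ENNReal.ofReal ((w (z.1, z.2 + y) - w z) ^ 2)
            + 2 * (W z * W (z.1, z.2 + y))) := by
          refine lintegral_mono fun z => ?_
          exact ofReal_sq_le_add_two_mul (hw0 _) (hw0 _)
      _ = (∫⁻ z in U, ENNReal.ofReal ((w (z.1, z.2 + y) - w z) ^ 2))
            + 2 * ∫⁻ z in U, W z * W (z.1, z.2 + y) := by
          rw [lintegral_add_left (by fun_prop), lintegral_const_mul' _ _ (by norm_num)]
      _ ≤ _ := by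
          gcongr
          refine (hD y (by linarith)).trans ?_
          gcongr
  have swap : ∫⁻ y in Metric.ball (0 : 𝔼) h, ∫⁻ z in U, W z * W (z.1, z.2 + y)
      ≤ ENNReal.ofReal s * A' := by
    set N : ℝ → ℝ≥0∞ := fun t => ∫⁻ x in Metric.ball (0 : 𝔼) (r + h), W (t, x) with hN
    have hNm : Measurable N := by
      exact Measurable.lintegral_prod_right' (ν := volume.restrict (Metric.ball (0 : 𝔼) (r + h))) hWm
    calc ∫⁻ y in Metric.ball (0 : 𝔼) h, ∫⁻ z in U, W z * W (z.1, z.2 + y)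
        = ∫⁻ z in U, ∫⁻ y in Metric.ball (0 : 𝔼) h, W z * W (z.1, z.2 + y) := by
          refine lintegral_lintegral_swap (Measurable.aemeasurable ?_)
          exact (hWm.comp measurable_snd).mul hWy
      _ ≤ ∫⁻ z in U, W z * N z.1 := by
          refine lintegral_mono_ae ?_
          rw [ae_restrict_iff' (measurableSet_Ioo.prod measurableSet_ball)]
          refine Filter.Eventually.of_forall fun z hz => ?_
          rw [lintegral_const_mul _ (by fun_prop)]
          gcongr
          have hz2 : ‖z.2‖ < r := by simpa using hz.2
          calc ∫⁻ y in Metric.ball (0 : 𝔼) h, W (z.1, z.2 + y)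
              = ∫⁻ y, (Metric.ball (0 : 𝔼) h).indicator (fun y => W (z.1, z.2 + y)) y :=
                (lintegral_indicator measurableSet_ball _).symm
            _ ≤ ∫⁻ y, (Metric.ball (0 : 𝔼) (r + h)).indicator (fun x => W (z.1, x)) (z.2 + y) := by
                refine lintegral_mono fun y => ?_
                by_cases hy : y ∈ Metric.ball (0 : 𝔼) h
                · have : z.2 + y ∈ Metric.ball (0 : 𝔼) (r + h) := by
                    rw [mem_ball_zero_iff] at hy ⊢
                    exact (norm_add_le _ _).trans_lt (by linarith)
                  rw [indicator_of_mem hy, indicator_of_mem this]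
                · rw [indicator_of_notMem hy]; exact zero_le
            _ = N z.1 := by
                rw [lintegral_add_left_eq_self, lintegral_indicator measurableSet_ball]
      _ = ∫⁻ t in Ioo a b, ∫⁻ x in Metric.ball (0 : 𝔼) r, W (t, x) * N t := by
          rw [Measure.volume_eq_prod, setLIntegral_prod _ (Measurable.aemeasurable (by fun_prop))]
      _ ≤ ∫⁻ t in Ioo a b, N t ^ 2 := by
          refine lintegral_mono fun t => ?_
          rw [lintegral_mul_const _ (by fun_prop), sq]
          gcongr
          exact lintegral_mono_set (Metric.ball_subset_ball (by linarith))
      -- Cauchy–Schwarz on the support of each slice, whose measure is at most `s`.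
      _ ≤ ∫⁻ t in Ioo a b, ENNReal.ofReal s * ∫⁻ x in Metric.ball (0 : 𝔼) (r + h), W (t, x) ^ 2 := by
          refine lintegral_mono_ae ?_
          filter_upwards [hS] with t ht
          set S : Set 𝔼 := {x | x ∈ Metric.ball (0 : 𝔼) (r + h) ∧ w (t, x) ≠ 0} with hSdef
          have hSm : MeasurableSet S := by
            refine measurableSet_ball.inter ?_
            exact (hw.comp measurable_prodMk_left) (measurableSet_singleton 0).compl
          have e : N t = ∫⁻ x in S, W (t, x) := by
            simp only [hN]
            rw [← lintegral_indicator measurableSet_ball, ← lintegral_indicator hSm]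
            congr 1 with x
            by_cases hx : x ∈ Metric.ball (0 : 𝔼) (r + h)
            · by_cases h0 : w (t, x) = 0
              · simp [indicator, hW, h0]
              · rw [indicator_of_mem hx, indicator_of_mem (show x ∈ S from ⟨hx, h0⟩)]
            · rw [indicator_of_notMem hx, indicator_of_notMem fun hxS => hx hxS.1]
          rw [e]
          refine (sq_lintegral_le _ (Measurable.aemeasurable (by fun_prop))).trans ?_
          rw [Measure.restrict_apply_univ]
          gcongr
          · exact le_trans (measure_mono (inter_subset_inter_left {x | w (t, x) ≠ 0} hsub)) ht
          · exact fun x hx => hx.1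
      _ = ENNReal.ofReal s * A' := by
          rw [lintegral_const_mul' _ _ ENNReal.ofReal_ne_top, hA', Measure.volume_eq_prod,
            setLIntegral_prod _ (Measurable.aemeasurable (by fun_prop))]
          simp only [hWsq]
  have avg : V * A ≤ V * (ENNReal.ofReal (h ^ 2) * g) + 2 * (ENNReal.ofReal s * A') := by
    calc V * A = ∫⁻ _ in Metric.ball (0 : 𝔼) h, A := by
          rw [setLIntegral_const, mul_comm]
      _ ≤ ∫⁻ y in Metric.ball (0 : 𝔼) h,
            (ENNReal.ofReal (h ^ 2) * g + 2 * ∫⁻ z in U, W z * W (z.1, z.2 + y)) :=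
          setLIntegral_mono' measurableSet_ball step
      _ = V * (ENNReal.ofReal (h ^ 2) * g)
            + 2 * ∫⁻ y in Metric.ball (0 : 𝔼) h, ∫⁻ z in U, W z * W (z.1, z.2 + y) := by
          rw [lintegral_add_left measurable_const, setLIntegral_const,
            lintegral_const_mul' _ _ (by norm_num), mul_comm]
      _ ≤ _ := by gcongr
  have h4 : 2 * (ENNReal.ofReal s * A') ≤ V * (4⁻¹ * A') := by
    calc 2 * (ENNReal.ofReal s * A') = (4 * 4⁻¹) * (2 * (ENNReal.ofReal s * A')) := by
          rw [ENNReal.mul_inv_cancel (by norm_num) (by norm_num), one_mul]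
      _ = (8 * ENNReal.ofReal s) * (4⁻¹ * A') := by ring
      _ ≤ _ := by gcongr
  have := avg.trans (add_le_add_right h4 _)
  rw [← mul_add] at this
  exact (ENNReal.mul_le_mul_iff_right hV0 hVtop).1 this

/-- A local Faber–Krahn inequality: if at almost every time `w` is supported in a set of measure at
most `s`, then its `L²` norm is controlled by its gradient with the factor `s ^ (1 / d)`. -/
theorem local_faberKrahn (hd : 1 ≤ d) {a b r R s : ℝ} {g : ℝ≥0∞}
    {w : ℝ × 𝔼 → ℝ} (hw : Measurable w) (hw0 : ∀ z, 0 ≤ w z)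
    (hD : ∀ (r' : ℝ) (y : 𝔼), r' + ‖y‖ ≤ R →
      ∫⁻ z in Ioo a b ×ˢ Metric.ball 0 r', ENNReal.ofReal ((w (z.1, z.2 + y) - w z) ^ 2)
        ≤ ENNReal.ofReal (‖y‖ ^ 2) * g)
    (hs : 0 < s)
    (hS : ∀ᵐ t ∂(volume.restrict (Ioo a b)),
      volume {x | x ∈ Metric.ball (0 : 𝔼) R ∧ w (t, x) ≠ 0} ≤
        ENNReal.ofReal s)
    (hrR : r < R) :
    ∫⁻ z in Ioo a b ×ˢ Metric.ball 0 r, ENNReal.ofReal (w z ^ 2)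
      ≤ ENNReal.ofReal
          (4 * (8 * s / volume.real (Metric.ball (0 : 𝔼) 1)) ^ (2 / (d : ℝ)))
        * (g + ENNReal.ofReal (1 / (R - r) ^ 2) *
          ∫⁻ z in Ioo a b ×ˢ Metric.ball 0 R, ENNReal.ofReal (w z ^ 2)) := by
  set A : ℝ → ℝ≥0∞ := fun r => ∫⁻ z in Ioo a b ×ˢ Metric.ball (0 : 𝔼) r, ENNReal.ofReal (w z ^ 2)
  set κ : ℝ := volume.real (Metric.ball (0 : 𝔼) 1) with hκ
  have hκ0 : 0 < κ := ENNReal.toReal_pos (Metric.measure_ball_pos volume _ one_pos).ne'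
    measure_ball_lt_top.ne
  have hd0 : (0 : ℝ) < d := by exact_mod_cast hd
  -- The radius for which the ball of radius `h` has measure exactly `8 * s`.
  set h : ℝ := (8 * s / κ) ^ (1 / (d : ℝ)) with hh
  have hh0 : 0 < h := by positivity
  have hhd : h ^ d = 8 * s / κ := by
    rw [hh, ← Real.rpow_natCast, ← Real.rpow_mul (by positivity), one_div_mul_cancel hd0.ne',
      Real.rpow_one]
  have hh2 : (8 * s / κ) ^ (2 / (d : ℝ)) = h ^ 2 := by
    rw [hh, ← Real.rpow_natCast, ← Real.rpow_mul (by positivity)]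
    congr 1
    push_cast; ring
  have hball : 8 * ENNReal.ofReal s ≤ volume (Metric.ball (0 : 𝔼) h) := by
    rw [Measure.addHaar_ball_of_pos _ _ hh0, finrank_euclideanSpace_fin, hhd,
      ← ENNReal.ofReal_toReal (measure_ball_lt_top (μ := volume) (x := (0 : 𝔼)) (r := 1)).ne,
      ← ENNReal.ofReal_mul (by positivity), ← ENNReal.ofReal_ofNat, ← ENNReal.ofReal_mul (by norm_num)]
    refine ENNReal.ofReal_le_ofReal (le_of_eq ?_)
    change 8 * s = 8 * s / κ * κ
    field_simp
  have step : ∀ r', r' + h ≤ R → A r' ≤ ENNReal.ofReal (h ^ 2) * g + 4⁻¹ * A (r' + h) := fun r' hr' =>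
    lintegral_sq_le_of_translate hw hw0 (hD r') hS hh0 hr' hball
  have hmono : ∀ {r₁ r₂ : ℝ}, r₁ ≤ r₂ → A r₁ ≤ A r₂ := fun h12 =>
    lintegral_mono_set (prod_mono_right (Metric.ball_subset_ball h12))
  -- Each step costs `h` in the radius and gains a factor `1 / 4`; the accumulated gradient terms
  -- form a geometric series bounded by `2`.
  have iter : ∀ (m : ℕ) (r' : ℝ), r' + m * h ≤ R →
      A r' ≤ 2 * (ENNReal.ofReal (h ^ 2) * g) + (4⁻¹) ^ m * A R := by
    intro m
    induction m with
    | zero =>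
      intro r' hr'
      have := hmono (r₁ := r') (r₂ := R) (by simpa using hr')
      simpa using this.trans le_add_self
    | succ m ih =>
      intro r' hr'
      push_cast at hr'
      have h1 := step r' (by nlinarith [mul_nonneg (Nat.cast_nonneg (α := ℝ) m) hh0.le])
      have h2 := ih (r' + h) (by linarith)
      refine h1.trans ?_
      calc ENNReal.ofReal (h ^ 2) * g + 4⁻¹ * A (r' + h)
          ≤ ENNReal.ofReal (h ^ 2) * g
            + 4⁻¹ * (2 * (ENNReal.ofReal (h ^ 2) * g) + (4⁻¹) ^ m * A R) := by gcongr
        _ = (1 + 4⁻¹ * 2) * (ENNReal.ofReal (h ^ 2) * g) + (4⁻¹) ^ (m + 1) * A R := by ring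
        _ ≤ _ := by
          gcongr
          have : (4⁻¹ : ℝ≥0∞) * 2 ≤ 4⁻¹ * 4 := by gcongr; norm_num
          rw [ENNReal.inv_mul_cancel (by norm_num) (by norm_num)] at this
          calc (1 : ℝ≥0∞) + 4⁻¹ * 2 ≤ 1 + 1 := by gcongr
            _ = 2 := by norm_num
  have hδ : 0 < R - r := sub_pos.2 hrR
  have final : A r ≤ 2 * (ENNReal.ofReal (h ^ 2) * g)
      + ENNReal.ofReal (4 * h ^ 2 * (1 / (R - r) ^ 2)) * A R := by
    -- If the gap is smaller than `h`, the coefficient of `A R` is at least `1` and monotonicity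
    -- suffices. Otherwise `m = ⌊(R - r) / h⌋` steps fit, and `R - r < (m + 1) * h ≤ 2 * 2 ^ m * h`
    -- turns `4⁻¹ ^ m` into `4 * h ^ 2 / (R - r) ^ 2`.
    by_cases hle : R - r < h
    · refine (hmono hrR.le).trans (le_trans ?_ le_add_self)
      refine le_mul_of_one_le_left' ?_
      rw [ENNReal.one_le_ofReal, mul_one_div, le_div_iff₀ (by positivity)]
      nlinarith
    · push Not at hle
      set m : ℕ := ⌊(R - r) / h⌋₊ with hm
      have hm1 : 1 ≤ m := (Nat.one_le_floor_iff _).2 ((one_le_div hh0).2 hle)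
      have hmle : (m : ℝ) ≤ (R - r) / h := Nat.floor_le (by positivity)
      have hlt : (R - r) / h < m + 1 := Nat.lt_floor_add_one _
      have hmR : (1 : ℝ) ≤ m := by exact_mod_cast hm1
      refine (iter m r ?_).trans ?_
      · rw [le_div_iff₀ hh0] at hmle; linarith
      · gcongr
        have h2m : (m : ℝ) ≤ 2 ^ m := by exact_mod_cast (Nat.lt_two_pow_self).le
        have e : ((4 : ℝ≥0∞)⁻¹) ^ m = ENNReal.ofReal ((1 / 4) ^ m) := by
          rw [ENNReal.ofReal_pow (by norm_num), one_div, ENNReal.ofReal_inv_of_pos (by norm_num),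
            ENNReal.ofReal_ofNat]
        rw [e]
        refine ENNReal.ofReal_le_ofReal ?_
        have hx : (R - r) ≤ 2 * 2 ^ m * h := by
          rw [div_lt_iff₀ hh0] at hlt
          nlinarith
        rw [mul_one_div, le_div_iff₀ (by positivity)]
        have h4m : (4 : ℝ) ^ m = 2 ^ m * 2 ^ m := by rw [← mul_pow]; norm_num
        have hp : (0 : ℝ) < 4 ^ m := by positivity
        rw [one_div, inv_pow, inv_mul_le_iff₀ hp, h4m]
        nlinarith
  refine final.trans ?_
  rw [hh2, mul_add, ← mul_assoc, ← mul_assoc, ← ENNReal.ofReal_mul (by positivity)]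
  gcongr
  rw [← ENNReal.ofReal_ofNat, ← ENNReal.ofReal_mul (by norm_num)]
  exact ENNReal.ofReal_le_ofReal (by nlinarith [sq_nonneg h])

/-! ### Parabolic energy and higher integrability of truncations. -/

/-- The cylinder `(-ρ, 0) × B_ρ`. -/
def spaceTimeCylinder (d : ℕ) (ρ : ℝ) : Set (ℝ × EuclideanSpace ℝ (Fin d)) :=
  Ioo (-ρ) 0 ×ˢ Metric.ball 0 ρ

theorem measurableSet_spaceTimeCylinder (ρ : ℝ) : MeasurableSet (spaceTimeCylinder d ρ) :=
  measurableSet_Ioo.prod measurableSet_ball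

theorem spaceTimeCylinder_mono {r R : ℝ} (h : r ≤ R) :
    spaceTimeCylinder d r ⊆ spaceTimeCylinder d R :=
  prod_mono (Ioo_subset_Ioo_left (by linarith)) (Metric.ball_subset_ball h)

theorem volume_spaceTimeCylinder_lt_top (ρ : ℝ) : volume (spaceTimeCylinder d ρ) < ⊤ := by
  rw [spaceTimeCylinder, Measure.volume_eq_prod, Measure.prod_prod]
  exact ENNReal.mul_lt_top measure_Ioo_lt_top measure_ball_lt_top

theorem setLIntegral_spaceTimeCylinder {ρ : ℝ} {f : ℝ × 𝔼 → ℝ≥0∞}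
    (hf : AEMeasurable f (volume.restrict (spaceTimeCylinder d ρ))) :
    ∫⁻ z in spaceTimeCylinder d ρ, f z
      = ∫⁻ t in Ioo (-ρ) 0, ∫⁻ x in Metric.ball (0 : 𝔼) ρ, f (t, x) := by
  rw [spaceTimeCylinder, Measure.volume_eq_prod] at *
  exact setLIntegral_prod _ hf

/-- The parabolic energy of `v`, with spatial gradient `G`, on `(-ρ, 0) × B_ρ` is at most `E`. -/
structure EnergyBound (v : ℝ × 𝔼 → ℝ) (G : ℝ × 𝔼 → 𝔼) (ρ E : ℝ) : Prop where
  slice : ∀ᵐ t ∂(volume.restrict (Ioo (-ρ) 0)),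
    ∫⁻ x in Metric.ball (0 : 𝔼) ρ, ENNReal.ofReal (v (t, x) ^ 2) ≤ ENNReal.ofReal E
  gradient : ∫⁻ z in spaceTimeCylinder d ρ, ENNReal.ofReal (‖G z‖ ^ 2) ≤ ENNReal.ofReal E

theorem EnergyBound.lintegral_sq_le {v : ℝ × 𝔼 → ℝ} {G : ℝ × 𝔼 → 𝔼} {ρ E : ℝ}
    (h : EnergyBound v G ρ E) (hv : Measurable v) (hρ : ρ ≤ 1) :
    ∫⁻ z in spaceTimeCylinder d ρ, ENNReal.ofReal (v z ^ 2) ≤ ENNReal.ofReal E := by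
  rw [setLIntegral_spaceTimeCylinder (by fun_prop)]
  refine (lintegral_mono_ae h.slice).trans ?_
  rw [setLIntegral_const, Real.volume_Ioo]
  refine mul_le_of_le_one_right' (ENNReal.ofReal_le_one.2 (by linarith))

theorem EnergyBound.integrableOn {v : ℝ × 𝔼 → ℝ} {G : ℝ × 𝔼 → 𝔼} {ρ E : ℝ}
    (h : EnergyBound v G ρ E) (hv : Measurable v) (hρ : ρ ≤ 1) :
    IntegrableOn v (spaceTimeCylinder d ρ) := by
  have : IsFiniteMeasure (volume.restrict (spaceTimeCylinder d ρ)) :=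
    ⟨by simpa using volume_spaceTimeCylinder_lt_top ρ⟩
  have h2 : MemLp v 2 (volume.restrict (spaceTimeCylinder d ρ)) := by
    refine ⟨hv.aestronglyMeasurable, ?_⟩
    rw [eLpNorm_lt_top_iff_lintegral_rpow_enorm_lt_top (by norm_num) (by norm_num)]
    have := (h.lintegral_sq_le hv hρ).trans_lt ENNReal.ofReal_lt_top
    simpa [ofReal_sq_eq_enorm] using this
  exact h2.integrable (by norm_num)

/-- Chebyshev's inequality for the superlevel sets. -/
theorem measure_superlevel_le {v : 𝔼 → ℝ} (hv : Measurable v) {R E l : ℝ}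
    (hl : 0 < l) (h : ∫⁻ x in Metric.ball (0 : 𝔼) R, ENNReal.ofReal (v x ^ 2) ≤ ENNReal.ofReal E) :
    volume {x | x ∈ Metric.ball (0 : 𝔼) R ∧ max (v x - l) 0 ≠ 0} ≤ ENNReal.ofReal (E / l ^ 2) := by
  have hl2 : 0 < l ^ 2 := by positivity
  rw [ENNReal.ofReal_div_of_pos hl2, ENNReal.le_div_iff_mul_le
    (Or.inl (ENNReal.ofReal_pos.2 hl2).ne') (Or.inl ENNReal.ofReal_ne_top), mul_comm]
  refine le_trans ?_ h
  have hm : MeasurableSet {x | ENNReal.ofReal (l ^ 2) ≤ ENNReal.ofReal (v x ^ 2)} :=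
    measurableSet_le measurable_const (by fun_prop)
  refine le_trans ?_ (mul_meas_ge_le_lintegral (μ := volume.restrict (Metric.ball (0 : 𝔼) R))
    (f := fun x => ENNReal.ofReal (v x ^ 2)) (by fun_prop) (ENNReal.ofReal (l ^ 2)))
  refine mul_le_mul' le_rfl ?_
  rw [Measure.restrict_apply hm]
  refine measure_mono fun x hx => ⟨?_, hx.1⟩
  have hlx : l < v x := by
    by_contra hle
    exact hx.2 (max_eq_right (by linarith [not_lt.1 hle]))
  exact ENNReal.ofReal_le_ofReal (by gcongr)

theorem sq_max_sub_le (x y l : ℝ) : (max (x - l) 0 - max (y - l) 0) ^ 2 ≤ (x - y) ^ 2 := by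
  rw [sq_le_sq]
  simpa using abs_max_sub_max_le_abs (x - l) (y - l) 0

/-- The constant of the truncated parabolic Sobolev inequality. -/
noncomputable def levelConst (d : ℕ) : ℝ :=
  8 * (8 / volume.real (Metric.ball (0 : EuclideanSpace ℝ (Fin d)) 1)) ^ (2 / (d : ℝ))

theorem volumeReal_ball_pos : 0 < volume.real (Metric.ball (0 : 𝔼) 1) :=
  ENNReal.toReal_pos (Metric.measure_ball_pos volume _ one_pos).ne' measure_ball_lt_top.ne

theorem levelConst_pos (d : ℕ) : 0 < levelConst d := by
  have := volumeReal_ball_pos (d := d)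
  unfold levelConst; positivity

/-- By Chebyshev each slice of the truncation lives on a set of measure at most `E / l ^ 2`, so the
Faber–Krahn factor is of order `(E / l ^ 2) ^ (2 / d)`. Truncation is a contraction, so the
translation estimate of `v` passes to it without computing its gradient. -/
theorem EnergyBound.lintegral_sq_truncation_le (hd : 1 ≤ d) {v : ℝ × 𝔼 → ℝ} {G : ℝ × 𝔼 → 𝔼}
    {r R E l : ℝ} (h : EnergyBound v G R E) (hv : Measurable v) (hv0 : ∀ z, 0 ≤ v z)
    (hG : HasL2SpatialGradient (spaceTimeCylinder d R) v G)
    (hr : 0 < r) (hrR : r < R) (hR : R ≤ 1) (hE : 0 < E) (hl : 0 < l) :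
    ∫⁻ z in spaceTimeCylinder d r, ENNReal.ofReal (max (v z - l) 0 ^ 2)
      ≤ ENNReal.ofReal (levelConst d * l ^ (-(4 / (d : ℝ))) * E ^ (1 + 2 / (d : ℝ)) / (R - r) ^ 2) := by
  have hκ := volumeReal_ball_pos (d := d)
  have hsq := h.lintegral_sq_le hv hR
  have hδ : 0 < R - r := sub_pos.2 hrR
  have hle : ∀ z, max (v z - l) 0 ^ 2 ≤ v z ^ 2 := fun z => by
    gcongr
    exact max_le (by linarith [hv0 z]) (hv0 z)
  have key := local_faberKrahn hd (a := -R) (b := 0) (r := r) (R := R) (s := E / l ^ 2)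
    (g := ENNReal.ofReal E) (w := fun z => max (v z - l) 0) (by fun_prop) (fun z => le_max_right _ _)
    ?_ (by positivity) ?_ hrR
  · have hsub : spaceTimeCylinder d r ⊆ Ioo (-R) 0 ×ˢ Metric.ball 0 r :=
      prod_mono (Ioo_subset_Ioo_left (by linarith)) le_rfl
    refine (lintegral_mono_set hsub).trans (key.trans ?_)
    have hA : ∫⁻ z in Ioo (-R) 0 ×ˢ Metric.ball (0 : 𝔼) R, ENNReal.ofReal (max (v z - l) 0 ^ 2)
        ≤ ENNReal.ofReal E :=
      le_trans (lintegral_mono fun z => ENNReal.ofReal_le_ofReal (hle z)) hsq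
    calc _ ≤ ENNReal.ofReal (4 * (8 * (E / l ^ 2) / volume.real (Metric.ball (0 : 𝔼) 1)) ^ (2 / (d : ℝ)))
          * (ENNReal.ofReal E + ENNReal.ofReal (1 / (R - r) ^ 2) * ENNReal.ofReal E) := by gcongr
      _ ≤ _ := by
        rw [← ENNReal.ofReal_mul (by positivity), ← ENNReal.ofReal_add (by positivity) (by positivity),
          ← ENNReal.ofReal_mul (by positivity)]
        refine ENNReal.ofReal_le_ofReal ?_
        have e1 : 8 * (E / l ^ 2) / volume.real (Metric.ball (0 : 𝔼) 1)
            = 8 / volume.real (Metric.ball (0 : 𝔼) 1) * E * (l ^ 2)⁻¹ := by ring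
        have e2 : ((l ^ 2)⁻¹) ^ (2 / (d : ℝ)) = l ^ (-(4 / (d : ℝ))) := by
          rw [Real.inv_rpow (by positivity), ← Real.rpow_natCast l 2, ← Real.rpow_mul hl.le,
            ← Real.rpow_neg hl.le]
          congr 1
          push_cast; ring
        rw [e1, Real.mul_rpow (by positivity) (by positivity), Real.mul_rpow (by positivity) hE.le, e2,
          Real.rpow_add hE, Real.rpow_one, levelConst]
        have h1 : 1 ≤ 1 / (R - r) ^ 2 := by
          rw [le_div_iff₀ (by positivity)]; nlinarith
        set K := (8 / volume.real (Metric.ball (0 : 𝔼) 1)) ^ (2 / (d : ℝ))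
        set L := l ^ (-(4 / (d : ℝ)))
        have hP : 0 ≤ K * E ^ (2 / (d : ℝ)) * L * E := by positivity
        calc 4 * (K * E ^ (2 / (d : ℝ)) * L) * (E + 1 / (R - r) ^ 2 * E)
            = 4 * (K * E ^ (2 / (d : ℝ)) * L * E) * (1 + 1 / (R - r) ^ 2) := by ring
          _ ≤ 4 * (K * E ^ (2 / (d : ℝ)) * L * E) * (2 * (1 / (R - r) ^ 2)) := by
            gcongr; linarith
          _ = _ := by ring
  · intro r' y hy
    refine le_trans ?_ ((hG.lintegral_sq_translate_sub_le (h.integrableOn hv hR) hy).trans ?_)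
    · exact lintegral_mono fun z => ENNReal.ofReal_le_ofReal (sq_max_sub_le _ _ _)
    · gcongr; exact h.gradient
  · filter_upwards [h.slice] with t ht
    exact measure_superlevel_le (by fun_prop) hl ht

/-- A single term suffices: if `c * 2 ^ j ≤ a < c * 2 ^ (j + 1)`, then `a - c * 2 ^ j / 2 ≥ a / 2`,
and `a ^ (q - 2)` is comparable with `(c * 2 ^ j) ^ (q - 2)`. -/
theorem rpow_le_tsum_dyadic {q c a : ℝ} (hq : 0 < q) (hc : 0 < c) :
    ENNReal.ofReal (max (a - c) 0 ^ q) ≤ ∑' j : ℕ,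
      ENNReal.ofReal (4 * 2 ^ |q - 2| * (c * 2 ^ j) ^ (q - 2)) *
        ENNReal.ofReal (max (a - c * 2 ^ j / 2) 0 ^ 2) := by
  by_cases hac : a ≤ c
  · rw [max_eq_right (by linarith), Real.zero_rpow hq.ne']; simp
  push Not at hac
  have ha : 0 < a := hc.trans hac
  obtain ⟨j, hj1, hj2⟩ := exists_nat_pow_near ((one_le_div hc).2 hac.le) (one_lt_two (α := ℝ))
  rw [le_div_iff₀ hc] at hj1
  rw [div_lt_iff₀ hc, pow_succ] at hj2
  refine le_trans ?_ (ENNReal.le_tsum j)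
  have hcj : 0 < c * 2 ^ j := by positivity
  rw [← ENNReal.ofReal_mul (by positivity)]
  refine ENNReal.ofReal_le_ofReal ?_
  have h1 : max (a - c) 0 ^ q ≤ a ^ q :=
    Real.rpow_le_rpow (le_max_right _ _) (max_le (by linarith) ha.le) hq.le
  have h2 : a ^ q = (c * 2 ^ j) ^ (q - 2) * (a / (c * 2 ^ j)) ^ (q - 2) * a ^ 2 := by
    rw [← Real.mul_rpow hcj.le (by positivity), mul_div_cancel₀ _ hcj.ne', ← Real.rpow_natCast a 2,
      ← Real.rpow_add ha]
    norm_num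
  have hx1 : 1 ≤ a / (c * 2 ^ j) := by rw [one_le_div hcj]; linarith
  have hx2 : a / (c * 2 ^ j) ≤ 2 := by rw [div_le_iff₀ hcj]; linarith
  have h3 : (a / (c * 2 ^ j)) ^ (q - 2) ≤ 2 ^ |q - 2| :=
    calc (a / (c * 2 ^ j)) ^ (q - 2) ≤ (a / (c * 2 ^ j)) ^ |q - 2| :=
          Real.rpow_le_rpow_of_exponent_le hx1 (le_abs_self _)
      _ ≤ _ := Real.rpow_le_rpow (by positivity) hx2 (abs_nonneg _)
  have h4 : a ^ 2 ≤ 4 * max (a - c * 2 ^ j / 2) 0 ^ 2 := by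
    have : a / 2 ≤ max (a - c * 2 ^ j / 2) 0 := le_max_of_le_left (by linarith)
    nlinarith
  calc max (a - c) 0 ^ q ≤ a ^ q := h1
    _ = (c * 2 ^ j) ^ (q - 2) * (a / (c * 2 ^ j)) ^ (q - 2) * a ^ 2 := h2
    _ ≤ (c * 2 ^ j) ^ (q - 2) * 2 ^ |q - 2| * (4 * max (a - c * 2 ^ j / 2) 0 ^ 2) := by gcongr
    _ = _ := by ring

/-- Higher integrability of truncations of functions of finite parabolic energy, for all exponents
below `2 + 4 / d`. -/
theorem exists_lintegral_rpow_truncation_le (hd : 1 ≤ d) {q : ℝ} (hq : 0 < q)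
    (hq2 : q < 2 + 4 / (d : ℝ)) :
    ∃ C : ℝ, 0 < C ∧ ∀ (v : ℝ × 𝔼 → ℝ) (G : ℝ × 𝔼 → 𝔼) (r R E c : ℝ), EnergyBound v G R E →
      Measurable v → (∀ z, 0 ≤ v z) → HasL2SpatialGradient (spaceTimeCylinder d R) v G →
      0 < r → r < R → R ≤ 1 → 0 < E → 0 < c →
      ∫⁻ z in spaceTimeCylinder d r, ENNReal.ofReal (max (v z - c) 0 ^ q)
        ≤ ENNReal.ofReal (C * c ^ (q - 2 - 4 / (d : ℝ)) * E ^ (1 + 2 / (d : ℝ)) / (R - r) ^ 2) := by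
  set α : ℝ := 4 / (d : ℝ) with hα
  -- The ratio of the dyadic sum, which is below `1` because `q < 2 + 4 / d`.
  set θ : ℝ := 2 ^ (q - 2 - α) with hθ
  have hθ0 : 0 < θ := by positivity
  have hθ1 : θ < 1 := Real.rpow_lt_one_of_one_lt_of_neg one_lt_two (by linarith)
  have hL := levelConst_pos d
  have h1θ : 0 < 1 - θ := sub_pos.2 hθ1
  refine ⟨4 * 2 ^ |q - 2| * levelConst d * 2 ^ α / (1 - θ), by positivity, ?_⟩
  intro v G r R E c h hv hv0 hG hr hrR hR hE hc
  set Y : ℝ := E ^ (1 + 2 / (d : ℝ)) / (R - r) ^ 2 with hY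
  have hδ : 0 < R - r := sub_pos.2 hrR
  have hY0 : 0 < Y := by positivity
  set B : ℝ := 4 * 2 ^ |q - 2| * levelConst d * 2 ^ α * c ^ (q - 2 - α) * Y with hB
  have hB0 : 0 < B := by positivity
  calc ∫⁻ z in spaceTimeCylinder d r, ENNReal.ofReal (max (v z - c) 0 ^ q)
      ≤ ∫⁻ z in spaceTimeCylinder d r, ∑' j : ℕ,
          ENNReal.ofReal (4 * 2 ^ |q - 2| * (c * 2 ^ j) ^ (q - 2)) *
            ENNReal.ofReal (max (v z - c * 2 ^ j / 2) 0 ^ 2) :=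
        lintegral_mono fun z => rpow_le_tsum_dyadic hq hc
    _ = ∑' j : ℕ, ENNReal.ofReal (4 * 2 ^ |q - 2| * (c * 2 ^ j) ^ (q - 2)) *
          ∫⁻ z in spaceTimeCylinder d r, ENNReal.ofReal (max (v z - c * 2 ^ j / 2) 0 ^ 2) := by
        rw [lintegral_tsum fun j => by fun_prop]
        congr 1 with j
        rw [lintegral_const_mul' _ _ ENNReal.ofReal_ne_top]
    _ ≤ ∑' j : ℕ, ENNReal.ofReal (B * θ ^ j) := by
        refine ENNReal.tsum_le_tsum fun j => ?_
        have hcj : 0 < c * 2 ^ j := by positivity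
        refine (mul_le_mul' le_rfl (h.lintegral_sq_truncation_le hd hv hv0 hG hr hrR hR hE
          (l := c * 2 ^ j / 2) (by positivity))).trans ?_
        rw [← ENNReal.ofReal_mul (by positivity)]
        refine ENNReal.ofReal_le_ofReal (le_of_eq ?_)
        have e1 : (c * 2 ^ j / 2) ^ (-α) = (c * 2 ^ j) ^ (-α) * 2 ^ α := by
          rw [Real.div_rpow hcj.le (by norm_num), Real.rpow_neg (by norm_num : (0 : ℝ) ≤ 2), div_inv_eq_mul]
        have e2 : (c * 2 ^ j) ^ (q - 2) * (c * 2 ^ j) ^ (-α) = c ^ (q - 2 - α) * θ ^ j := by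
          rw [← Real.rpow_add hcj, ← sub_eq_add_neg, Real.mul_rpow hc.le (by positivity), hθ,
            ← Real.rpow_natCast 2 j, ← Real.rpow_mul (by norm_num), ← Real.rpow_natCast (2 ^ _) j,
            ← Real.rpow_mul (by norm_num), mul_comm (j : ℝ)]
        rw [e1]
        calc _ = 4 * 2 ^ |q - 2| * levelConst d * 2 ^ α *
              ((c * 2 ^ j) ^ (q - 2) * (c * 2 ^ j) ^ (-α)) * Y := by rw [hY]; ring
          _ = _ := by rw [e2, hB]; ring
    _ = ENNReal.ofReal (B * (1 - θ)⁻¹) := by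
        rw [← ENNReal.ofReal_tsum_of_nonneg (fun j => by positivity)
          ((summable_geometric_of_lt_one hθ0.le hθ1).mul_left B), tsum_mul_left,
          tsum_geometric_of_lt_one hθ0.le hθ1]
    _ = _ := by
        congr 1
        rw [hB, hY]; ring

theorem EnergyBound.mono {v : ℝ × 𝔼 → ℝ} {G : ℝ × 𝔼 → 𝔼} {ρ ρ' E E' : ℝ}
    (h : EnergyBound v G ρ E) (hρ : ρ' ≤ ρ) (hE : E ≤ E') : EnergyBound v G ρ' E' := by
  refine ⟨?_, ?_⟩
  · have := ae_mono (Measure.restrict_mono (Ioo_subset_Ioo_left (by linarith : -ρ ≤ -ρ')) le_rfl) h.slice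
    filter_upwards [this] with t ht
    exact (lintegral_mono_set (Metric.ball_subset_ball hρ)).trans
      (ht.trans (ENNReal.ofReal_le_ofReal hE))
  · exact (lintegral_mono_set (spaceTimeCylinder_mono hρ)).trans
      (h.gradient.trans (ENNReal.ofReal_le_ofReal hE))

/-! ### From the energy inequality to energy bounds. -/

/-- The energy inequality for the truncation at level `k` on the concentric balls of radius at most
`1`, with the spatial gradient `G` of the truncation. -/
structure LevelEnergy (γ₁ γ₂ γ₃ p : ℝ) (u : ℝ × 𝔼 → ℝ) (k : ℝ) (G : ℝ × 𝔼 → 𝔼) : Prop where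
  gradient : HasL2SpatialGradient (spaceTimeCylinder d 1) (fun z => max (u z - k) 0) G
  energy : ∀ r R : ℝ, 0 < r → r < R → R ≤ 1 →
    ∀ᵐ s ∂(volume.restrict (Ioo (-1) 0)), ∀ᵐ t ∂(volume.restrict (Ioo (-1) 0)),
      s < t → EnergyInequality γ₁ γ₂ γ₃ p u k G 0 r R s t

theorem ae_restrict_exists_mem {a b : ℝ} (hab : a < b) {P : ℝ → Prop}
    (h : ∀ᵐ t ∂(volume.restrict (Ioo a b)), P t) : ∃ t ∈ Ioo a b, P t := by
  have : (ae (volume.restrict (Ioo a b))).NeBot := by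
    rw [ae_neBot, Ne, Measure.restrict_eq_zero, Real.volume_Ioo, ENNReal.ofReal_eq_zero]
    linarith
  obtain ⟨t, ht1, ht2⟩ := (h.and (ae_restrict_mem measurableSet_Ioo)).exists
  exact ⟨t, ht2, ht1⟩

/-- A bound for the integral over an interval makes the integrand small at some time, chosen in any
set of full measure. -/
theorem exists_time_le_of_lintegral_le {f : ℝ → ℝ≥0∞} {a₀ b₀ c A : ℝ} (hab : a₀ < b₀) (hbc : b₀ ≤ c)
    (hA : 0 < A) (hf : ∫⁻ t in Ioo a₀ c, f t ≤ ENNReal.ofReal A) {P : ℝ → Prop}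
    (hP : ∀ᵐ t ∂(volume.restrict (Ioo a₀ c)), P t) :
    ∃ t ∈ Ioo a₀ b₀, P t ∧ f t ≤ ENNReal.ofReal (2 * A / (b₀ - a₀)) := by
  have hδ : 0 < b₀ - a₀ := sub_pos.2 hab
  by_contra hcon
  push Not at hcon
  have hsub : Ioo a₀ b₀ ⊆ Ioo a₀ c := Ioo_subset_Ioo_right hbc
  have hP' := ae_mono (Measure.restrict_mono hsub le_rfl) hP
  have h1 : ∫⁻ _ in Ioo a₀ b₀, ENNReal.ofReal (2 * A / (b₀ - a₀)) ≤ ENNReal.ofReal A := by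
    refine le_trans (lintegral_mono_ae ?_) ((lintegral_mono_set hsub).trans hf)
    filter_upwards [hP', ae_restrict_mem measurableSet_Ioo] with t ht hmem
    exact (hcon t hmem ht).le
  rw [setLIntegral_const, Real.volume_Ioo, ← ENNReal.ofReal_mul (by positivity),
    div_mul_cancel₀ _ hδ.ne', ENNReal.ofReal_le_ofReal_iff hA.le] at h1
  linarith

theorem setLIntegral_Ioo_le_of_forall_lt {f : ℝ → ℝ≥0∞} {a b : ℝ} {M : ℝ≥0∞}
    (h : ∀ t < b, ∫⁻ τ in Ioo a t, f τ ≤ M) : ∫⁻ τ in Ioo a b, f τ ≤ M := by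
  obtain ⟨t, htmono, htlt, htlim⟩ := exists_seq_strictMono_tendsto b
  have hU : Ioo a b = ⋃ n, Ioo a (t n) := by
    ext τ
    simp only [mem_Ioo, mem_iUnion]
    constructor
    · rintro ⟨h1, h2⟩
      obtain ⟨n, hn⟩ := (htlim.eventually (lt_mem_nhds h2)).exists
      exact ⟨n, h1, hn⟩
    · rintro ⟨n, h1, h2⟩
      exact ⟨h1, h2.trans (htlt n)⟩
  rw [hU, setLIntegral_iUnion_of_directed]
  · exact iSup_le fun n => h _ (htlt n)
  · exact (monotone_nat_of_le_succ fun n => Ioo_subset_Ioo_right (htmono.monotone n.le_succ)).directed_le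

/-- The energy estimate on a smaller cylinder, in terms of the `L²` and `L^p` norms. -/
theorem LevelEnergy.energyBound {γ₁ γ₂ γ₃ p : ℝ} (hγ₁ : 0 < γ₁) (hγ₂ : 0 < γ₂) (hγ₃ : 0 < γ₃)
    (hp : 1 ≤ p) {u : ℝ × 𝔼 → ℝ} (hu : Measurable u) {k : ℝ} {G : ℝ × 𝔼 → 𝔼}
    (h : LevelEnergy γ₁ γ₂ γ₃ p u k G) {r R A B : ℝ} (hr : 0 < r) (hrR : r < R) (hR : R ≤ 1)
    (hA : 0 < A) (hB : 0 ≤ B)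
    (h2 : ∫⁻ z in spaceTimeCylinder d R, ENNReal.ofReal (max (u z - k) 0 ^ 2) ≤ ENNReal.ofReal A)
    (hpB : ∫⁻ z in spaceTimeCylinder d R, ENNReal.ofReal (max (u z - k) 0 ^ p) ≤ ENNReal.ofReal B) :
    EnergyBound (fun z => max (u z - k) 0) G r
      ((1 + 1 / γ₁) * (2 + γ₂ + γ₃) * (A / (R - r) ^ 2 + B ^ (1 / p))) := by
  have hδ : 0 < R - r := sub_pos.2 hrR
  have hp0 : 0 < p := by linarith
  rw [setLIntegral_spaceTimeCylinder (by fun_prop)] at h2 hpB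
  set N : ℝ := A / (R - r) ^ 2 + B ^ (1 / p) with hN
  set M : ℝ := (2 + γ₂ + γ₃) * N with hM
  have hN0 : 0 < N := by positivity
  have hM0 : 0 < M := by positivity
  have hsub : Ioo (-R) 0 ⊆ Ioo (-1) 0 := Ioo_subset_Ioo_left (by linarith)
  -- A good initial time in the gap `(-R, -r)`, where the slice is at most twice its average bound,
  -- replaces a cutoff in time.
  obtain ⟨s, hs, hsE, hsf⟩ := exists_time_le_of_lintegral_le (a₀ := -R) (b₀ := -r) (c := 0)
    (by linarith) (by linarith) hA h2
    (ae_mono (Measure.restrict_mono hsub le_rfl) (h.energy r R hr hrR hR))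
  have e0 : -r - -R = R - r := by ring
  rw [e0] at hsf
  have hEI : ∀ᵐ t ∂(volume.restrict (Ioo (-1) 0)), s < t →
      (∫⁻ x in Metric.ball (0 : 𝔼) r, ENNReal.ofReal (max (u (t, x) - k) 0 ^ 2))
        + ENNReal.ofReal γ₁ *
          (∫⁻ τ in Ioo s t, ∫⁻ x in Metric.ball (0 : 𝔼) r, ENNReal.ofReal (‖G (τ, x)‖ ^ 2))
        ≤ ENNReal.ofReal M := by
    filter_upwards [hsE, ae_restrict_mem measurableSet_Ioo] with t ht htm hst
    have hI : Ioo s t ⊆ Ioo (-R) 0 := Ioo_subset_Ioo hs.1.le htm.2.le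
    refine (ht hst).trans ?_
    calc _ ≤ ENNReal.ofReal (2 * A / (R - r)) + ENNReal.ofReal (γ₂ / (R - r) ^ 2) * ENNReal.ofReal A
          + ENNReal.ofReal γ₃ * ENNReal.ofReal B ^ (1 / p) := by
          gcongr
          · exact (lintegral_mono_set hI).trans h2
          · exact (lintegral_mono_set hI).trans hpB
      _ = ENNReal.ofReal (2 * A / (R - r) + γ₂ / (R - r) ^ 2 * A + γ₃ * B ^ (1 / p)) := by
          rw [ENNReal.ofReal_rpow_of_nonneg hB (by positivity), ← ENNReal.ofReal_mul (by positivity),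
            ← ENNReal.ofReal_mul (by positivity), ← ENNReal.ofReal_add (by positivity) (by positivity),
            ← ENNReal.ofReal_add (by positivity) (by positivity)]
      _ ≤ ENNReal.ofReal M := by
          refine ENNReal.ofReal_le_ofReal ?_
          have hb : 0 ≤ B ^ (1 / p) := by positivity
          have ha : 0 ≤ A / (R - r) ^ 2 := by positivity
          have h3 : 2 * A / (R - r) ≤ 2 * (A / (R - r) ^ 2) := by
            rw [mul_div_assoc]
            gcongr
            nlinarith
          have h4 : γ₂ / (R - r) ^ 2 * A = γ₂ * (A / (R - r) ^ 2) := by ring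
          rw [hM, hN, h4]
          nlinarith [mul_nonneg hγ₂.le hb, mul_nonneg hγ₃.le ha]
  have hgoal1 : M ≤ (1 + 1 / γ₁) * (2 + γ₂ + γ₃) * N := by
    rw [mul_assoc]
    exact le_mul_of_one_le_left hM0.le (by linarith [one_div_pos.2 hγ₁])
  have hgoal2 : M / γ₁ ≤ (1 + 1 / γ₁) * (2 + γ₂ + γ₃) * N := by
    rw [mul_assoc, ← hM, div_eq_mul_one_div, mul_comm]
    gcongr
    linarith
  refine ⟨?_, ?_⟩
  · have := ae_mono (Measure.restrict_mono
      (Ioo_subset_Ioo_left (by linarith : (-1 : ℝ) ≤ -r)) le_rfl) hEI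
    filter_upwards [this, ae_restrict_mem measurableSet_Ioo] with t ht htm
    exact le_self_add.trans ((ht (hs.2.trans htm.1)).trans (ENNReal.ofReal_le_ofReal hgoal1))
  · have hGm : AEMeasurable (fun z => ENNReal.ofReal (‖G z‖ ^ 2))
        (volume.restrict (spaceTimeCylinder d r)) := by
      have : AEMeasurable G (volume.restrict (spaceTimeCylinder d r)) :=
        (h.gradient.memLp.aestronglyMeasurable.mono_measure
          (Measure.restrict_mono (spaceTimeCylinder_mono (by linarith)) le_rfl)).aemeasurable
      exact (this.norm.pow_const 2).ennreal_ofReal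
    rw [setLIntegral_spaceTimeCylinder hGm]
    refine le_trans ?_ (ENNReal.ofReal_le_ofReal hgoal2)
    -- The inequality holds only at almost every end time, so a good time is chosen beyond each `t'
    -- < 0`, and `t'` increases to `0`.
    refine setLIntegral_Ioo_le_of_forall_lt fun t' ht' => ?_
    have hmax : max t' (-r) < 0 := max_lt ht' (by linarith)
    obtain ⟨t, ht, hEt⟩ := ae_restrict_exists_mem hmax
      (ae_mono (Measure.restrict_mono
        (Ioo_subset_Ioo_left (le_max_of_le_right (by linarith : (-1 : ℝ) ≤ -r))) le_rfl) hEI)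
    have htr : -r < t := (le_max_right _ _).trans_lt ht.1
    have h5 := le_add_self.trans (hEt (hs.2.trans htr))
    rw [ENNReal.ofReal_div_of_pos hγ₁, ENNReal.le_div_iff_mul_le
      (Or.inl (ENNReal.ofReal_pos.2 hγ₁).ne') (Or.inl ENNReal.ofReal_ne_top), mul_comm]
    refine le_trans ?_ h5
    gcongr
    · exact hs.2.le
    · exact ((le_max_left _ _).trans_lt ht.1).le

/-! ### The local parabolic Sobolev inequality and a universal energy bound. -/

theorem rpow_le_two_rpow_mul {x c q : ℝ} (hx : 0 ≤ x) (hc : 0 ≤ c) (hq : 0 ≤ q) :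
    x ^ q ≤ 2 ^ q * (max (x - c) 0 ^ q + c ^ q) := by
  have h1 : 0 ≤ max (x - c) 0 := le_max_right _ _
  rcases le_total x (2 * c) with h | h
  · calc x ^ q ≤ (2 * c) ^ q := Real.rpow_le_rpow hx h hq
      _ = 2 ^ q * c ^ q := Real.mul_rpow (by norm_num) hc
      _ ≤ _ := by
        gcongr
        exact le_add_of_nonneg_left (by positivity)
  · calc x ^ q ≤ (2 * max (x - c) 0) ^ q :=
          Real.rpow_le_rpow hx (by linarith [le_max_left (x - c) 0]) hq
      _ = 2 ^ q * max (x - c) 0 ^ q := Real.mul_rpow (by norm_num) h1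
      _ ≤ _ := by
        gcongr
        exact le_add_of_nonneg_right (by positivity)

/-- The local parabolic Sobolev inequality, for exponents below `2 + 4 / d`. -/
theorem exists_lintegral_rpow_le (hd : 1 ≤ d) {q : ℝ} (hq : 0 < q) (hq2 : q < 2 + 4 / (d : ℝ)) :
    ∃ C : ℝ, 0 < C ∧ ∀ (v : ℝ × 𝔼 → ℝ) (G : ℝ × 𝔼 → 𝔼) (r R E : ℝ), EnergyBound v G R E →
      Measurable v → (∀ z, 0 ≤ v z) → HasL2SpatialGradient (spaceTimeCylinder d R) v G →
      0 < r → r < R → R ≤ 1 → 0 < E →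
      ∫⁻ z in spaceTimeCylinder d r, ENNReal.ofReal (v z ^ q)
        ≤ ENNReal.ofReal (C * E ^ (q / 2) / (R - r) ^ 2) := by
  obtain ⟨C, hC, H⟩ := exists_lintegral_rpow_truncation_le hd hq hq2
  set V : ℝ := volume.real (spaceTimeCylinder d 1) with hV
  have hV0 : 0 ≤ V := measureReal_nonneg
  refine ⟨2 ^ q * (C + V), by positivity, ?_⟩
  intro v G r R E h hv hv0 hG hr hrR hR hE
  have hδ : 0 < R - r := sub_pos.2 hrR
  -- The level that balances the two parts: above and below it, the bound scales as `E ^ (q / 2)`.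
  set c : ℝ := E ^ (1 / 2 : ℝ) with hc
  have hc0 : 0 < c := by positivity
  have key := H v G r R E c h hv hv0 hG hr hrR hR hE hc0
  have hce : c ^ (q - 2 - 4 / (d : ℝ)) * E ^ (1 + 2 / (d : ℝ)) = E ^ (q / 2) := by
    rw [hc, ← Real.rpow_mul hE.le, ← Real.rpow_add hE]
    congr 1; ring
  have hcq : c ^ q = E ^ (q / 2) := by
    rw [hc, ← Real.rpow_mul hE.le]
    congr 1; ring
  rw [mul_assoc C, hce] at key
  have hvol : volume (spaceTimeCylinder d r) ≤ ENNReal.ofReal V := by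
    rw [hV, measureReal_def, ENNReal.ofReal_toReal (volume_spaceTimeCylinder_lt_top 1).ne]
    exact measure_mono (spaceTimeCylinder_mono (by linarith))
  calc ∫⁻ z in spaceTimeCylinder d r, ENNReal.ofReal (v z ^ q)
      ≤ ∫⁻ z in spaceTimeCylinder d r, ENNReal.ofReal (2 ^ q) *
          (ENNReal.ofReal (max (v z - c) 0 ^ q) + ENNReal.ofReal (c ^ q)) := by
        refine lintegral_mono fun z => ?_
        rw [← ENNReal.ofReal_add (by positivity) (by positivity), ← ENNReal.ofReal_mul (by positivity)]
        exact ENNReal.ofReal_le_ofReal (rpow_le_two_rpow_mul (hv0 z) hc0.le hq.le)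
    _ = ENNReal.ofReal (2 ^ q) * ((∫⁻ z in spaceTimeCylinder d r, ENNReal.ofReal (max (v z - c) 0 ^ q))
          + ENNReal.ofReal (c ^ q) * volume (spaceTimeCylinder d r)) := by
        rw [lintegral_const_mul' _ _ ENNReal.ofReal_ne_top, lintegral_add_right _ measurable_const,
          setLIntegral_const]
    _ ≤ ENNReal.ofReal (2 ^ q) * (ENNReal.ofReal (C * E ^ (q / 2) / (R - r) ^ 2)
          + ENNReal.ofReal (c ^ q) * ENNReal.ofReal V) := by gcongr
    _ ≤ _ := by
        rw [← ENNReal.ofReal_mul (by positivity), ← ENNReal.ofReal_add (by positivity) (by positivity),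
          ← ENNReal.ofReal_mul (by positivity), hcq]
        refine ENNReal.ofReal_le_ofReal ?_
        have h1 : E ^ (q / 2) * V ≤ V * E ^ (q / 2) / (R - r) ^ 2 := by
          rw [le_div_iff₀ (by positivity), mul_comm V]
          exact mul_le_of_le_one_right (by positivity) (by nlinarith)
        calc _ ≤ 2 ^ q * (C * E ^ (q / 2) / (R - r) ^ 2 + V * E ^ (q / 2) / (R - r) ^ 2) := by gcongr
          _ = _ := by ring

/-- Young's inequality with `S = √E`. The weight `1 / 32` is chosen to beat the growth `16 ^ i` of
the remainder. -/
theorem absorb_sqrt_le {c b S : ℝ} (hc : 0 < c) (hb : 0 ≤ b) (hS : 0 ≤ S) (i : ℕ) :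
    c * (256 * 4 ^ i + b * S * (256 * 4 ^ i)) ≤
      S ^ 2 / 32 + (c * 256 * (1 + b) + 8 * (c * 256 * (1 + b)) ^ 2) * 16 ^ i := by
  set D : ℝ := c * 256 * (1 + b) with hD
  have hD0 : 0 < D := by positivity
  have h4 : (4 : ℝ) ^ i * 4 ^ i = 16 ^ i := by rw [← mul_pow]; norm_num
  have h41 : (1 : ℝ) ≤ 4 ^ i := one_le_pow₀ (by norm_num)
  have h416 : (4 : ℝ) ^ i ≤ 16 ^ i := by rw [← h4]; nlinarith
  have h1 : 1 + b * S ≤ (1 + b) * (1 + S) := by nlinarith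
  calc c * (256 * 4 ^ i + b * S * (256 * 4 ^ i))
      = c * 256 * (1 + b * S) * 4 ^ i := by ring
    _ ≤ c * 256 * ((1 + b) * (1 + S)) * 4 ^ i := by gcongr
    _ = D * 4 ^ i + S * (D * 4 ^ i) := by rw [hD]; ring
    _ ≤ D * 16 ^ i + (S ^ 2 / 32 + 8 * (D * 4 ^ i) ^ 2) := by
        have h2 : S * (D * 4 ^ i) ≤ S ^ 2 / 32 + 8 * (D * 4 ^ i) ^ 2 := by
          linarith [sq_nonneg (S - 16 * (D * 4 ^ i))]
        gcongr
    _ = _ := by rw [mul_pow, sq (4 ^ i : ℝ), h4]; ring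

/-- Descending from `m` to `0` divides the a priori bound by `32 ^ m`, while the errors sum to at
most `2 * F`, as `16 ^ i / 32 ^ i = 2 ^ (-i)`. Taking `m` large removes `E₀` from the result. -/
theorem absorb_iterate {P : ℕ → ℝ → Prop} {F E₀ : ℝ} (hF : 0 < F)
    (step : ∀ (i : ℕ) (E : ℝ), 0 < E → P (i + 1) E → P i (E / 32 + F * 16 ^ i))
    (mono : ∀ E E' : ℝ, E ≤ E' → P 0 E → P 0 E') (hE₀ : 0 < E₀) (h : ∀ m, P m E₀) :
    P 0 (1 + 2 * F) := by
  have iter : ∀ (m : ℕ) (E : ℝ), 0 < E → P m E → P 0 (E / 32 ^ m + 2 * F * (1 - (1 / 2) ^ m)) := by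
    intro m
    induction m with
    | zero => intro E _ h; simpa using h
    | succ m ih =>
      intro E hE h
      refine mono _ _ (le_of_eq ?_) (ih _ (by positivity) (step m E hE h))
      have e : (16 : ℝ) ^ m / 32 ^ m = (1 / 2) ^ m := by rw [← div_pow]; norm_num
      rw [add_div, mul_div_assoc F, e, pow_succ, pow_succ, div_div, mul_comm (32 : ℝ)]
      ring
  obtain ⟨m, hm⟩ := pow_unbounded_of_one_lt E₀ (by norm_num : (1 : ℝ) < 32)
  refine mono _ _ (add_le_add ?_ ?_) (iter m E₀ hE₀ (h m))
  · rw [div_le_one (by positivity)]; exact hm.le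
  · exact mul_le_of_le_one_right (by positivity) (by linarith [pow_pos (one_half_pos (α := ℝ)) m])

/-- A universal bound for the energy on a smaller cylinder: the `L^p` term of the energy inequality
is absorbed by iterating over a sequence of radii. -/
theorem exists_energyBound_of_lintegral_sq_le (hd : 1 ≤ d) {γ₁ γ₂ γ₃ p : ℝ}
    (hγ₁ : 0 < γ₁) (hγ₂ : 0 < γ₂) (hγ₃ : 0 < γ₃) (hp : 1 ≤ p) (hp2 : p < 2 + 4 / (d : ℝ)) :
    ∃ K : ℝ, 0 < K ∧ ∀ (u : ℝ × 𝔼 → ℝ) (k : ℝ) (G : ℝ × 𝔼 → 𝔼), Measurable u →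
      LevelEnergy γ₁ γ₂ γ₃ p u k G →
      (∃ E, 0 < E ∧ EnergyBound (fun z => max (u z - k) 0) G 1 E) →
      ∫⁻ z in spaceTimeCylinder d 1, ENNReal.ofReal (max (u z - k) 0 ^ 2) ≤ ENNReal.ofReal 1 →
      EnergyBound (fun z => max (u z - k) 0) G (3 / 4) K := by
  have hp0 : 0 < p := by linarith
  obtain ⟨C, hC, HC⟩ := exists_lintegral_rpow_le hd hp0 hp2
  set c₁ : ℝ := (1 + 1 / γ₁) * (2 + γ₂ + γ₃) with hc₁
  have hc₁0 : 0 < c₁ := by positivity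
  set D : ℝ := c₁ * 256 * (1 + C ^ (1 / p)) with hD
  have hD0 : 0 < D := by positivity
  set F : ℝ := D + 8 * D ^ 2 with hF
  have hF0 : 0 < F := by positivity
  refine ⟨1 + 2 * F, by positivity, ?_⟩
  rintro u k G hu hL ⟨E₀, hE₀, hEB⟩ hsq
  set v : ℝ × 𝔼 → ℝ := fun z => max (u z - k) 0 with hv
  have hvm : Measurable v := by fun_prop
  have hv0 : ∀ z, 0 ≤ v z := fun z => le_max_right _ _
  -- Radii increasing from `3 / 4` towards `1`. Each gap is halved below: the outer half serves the
  -- Sobolev inequality, the inner half the energy inequality.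
  set ρ : ℕ → ℝ := fun i => 1 - (1 / 4) * (1 / 2) ^ i with hρ
  have step : ∀ (i : ℕ) (E : ℝ), 0 < E → EnergyBound v G (ρ (i + 1)) E →
      EnergyBound v G (ρ i) (E / 32 + F * 16 ^ i) := by
    intro i E hE h
    set x : ℝ := (1 / 2) ^ i with hx
    have hx0 : 0 < x := by positivity
    have hx1 : x ≤ 1 := pow_le_one₀ (by norm_num) (by norm_num)
    have e0 : ρ i = 1 - x / 4 := by simp only [hρ, ← hx]; ring
    have e1 : ρ (i + 1) = 1 - x / 8 := by simp only [hρ, pow_succ, ← hx]; ring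
    have e4 : (4 : ℝ) ^ i = 1 / x ^ 2 := by
      rw [hx, ← pow_mul, mul_comm i 2, pow_mul]; norm_num [← inv_pow]
    rw [e1] at h
    rw [e0]
    have hb := HC v G (1 - 3 * x / 16) (1 - x / 8) E h hvm hv0
      (hL.gradient.mono (measurableSet_spaceTimeCylinder 1) (spaceTimeCylinder_mono (by linarith)))
      (by linarith) (by linarith) (by linarith) hE
    have ha : ∫⁻ z in spaceTimeCylinder d (1 - 3 * x / 16), ENNReal.ofReal (max (u z - k) 0 ^ 2)
        ≤ ENNReal.ofReal 1 := (lintegral_mono_set (spaceTimeCylinder_mono (by linarith))).trans hsq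
    have hstep := hL.energyBound hγ₁ hγ₂ hγ₃ hp hu (r := 1 - x / 4) (R := 1 - 3 * x / 16)
      (by linarith) (by linarith) (by linarith) one_pos (by positivity) ha hb
    refine hstep.mono le_rfl ?_
    have g1 : 1 - 3 * x / 16 - (1 - x / 4) = x / 16 := by ring
    have g2 : 1 - x / 8 - (1 - 3 * x / 16) = x / 16 := by ring
    rw [g1, g2]
    have g3 : 1 / (x / 16) ^ 2 = 256 * 4 ^ i := by rw [e4]; field_simp; norm_num
    -- The `L^p` term is sublinear in `E` whatever `p` is, which makes the absorption possible.
    have hEp : (E ^ (p / 2)) ^ (1 / p) = E ^ (1 / 2 : ℝ) := by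
      rw [← Real.rpow_mul hE.le]; congr 1; field_simp
    have g4 : (C * E ^ (p / 2) / (x / 16) ^ 2) ^ (1 / p)
        ≤ C ^ (1 / p) * E ^ (1 / 2 : ℝ) * (256 * 4 ^ i) := by
      rw [div_eq_mul_one_div, g3, Real.mul_rpow (by positivity) (by positivity),
        Real.mul_rpow (by positivity) (by positivity), hEp]
      gcongr
      have h1 : (1 : ℝ) ≤ 256 * 4 ^ i := by
        have : (1 : ℝ) ≤ 4 ^ i := one_le_pow₀ (by norm_num)
        linarith
      calc (256 * 4 ^ i : ℝ) ^ (1 / p) ≤ (256 * 4 ^ i : ℝ) ^ (1 : ℝ) :=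
            Real.rpow_le_rpow_of_exponent_le h1 (by rw [div_le_one hp0]; exact hp)
        _ = _ := Real.rpow_one _
    set S : ℝ := E ^ (1 / 2 : ℝ) with hS
    have hS0 : 0 < S := by positivity
    have hSS : S ^ 2 = E := by
      rw [hS, ← Real.rpow_natCast, ← Real.rpow_mul hE.le]; norm_num
    have hCp : 0 < C ^ (1 / p) := by positivity
    have habs := absorb_sqrt_le hc₁0 hCp.le hS0.le i
    rw [hSS] at habs
    refine le_trans ?_ habs
    rw [g3]
    gcongr
  have hρle : ∀ m, ρ m ≤ 1 := fun m => by
    simp only [hρ]; linarith [pow_pos (one_half_pos (α := ℝ)) m]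
  have := absorb_iterate (P := fun m E => EnergyBound v G (ρ m) E) hF0 step
    (fun _ _ hle h => h.mono le_rfl hle) hE₀ (fun m => hEB.mono (hρle m) le_rfl)
  exact this.mono (by norm_num [hρ]) le_rfl

/-! ### Small energy at the first level. -/

/-- Where the left side is nonzero, `1 ≤ 16 * a ^ 2`, so the constant `M ^ p` is paid for by the
square. This is why the iteration starts at a positive level. -/
theorem rpow_truncation_le {p M a : ℝ} (hp : 0 < p) (hM : 0 < M) :
    max (a - 1 / 4) 0 ^ p ≤
      2 ^ p * (max (max (a - 0) 0 - M) 0 ^ p + 16 * M ^ p * max (a - 0) 0 ^ 2) := by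
  rw [sub_zero]
  have h1 : 0 ≤ max (max a 0 - M) 0 := le_max_right _ _
  rcases le_total a (1 / 4) with h | h
  · rw [max_eq_right (by linarith), Real.zero_rpow hp.ne']
    positivity
  · have ha : 0 ≤ a := by linarith
    have e : max (a - 1 / 4) 0 = a - 1 / 4 := max_eq_left (by linarith)
    rw [max_eq_left ha] at h1 ⊢
    rw [e]
    calc (a - 1 / 4) ^ p ≤ a ^ p := Real.rpow_le_rpow (by linarith) (by linarith) hp.le
      _ ≤ 2 ^ p * (max (a - M) 0 ^ p + M ^ p) := rpow_le_two_rpow_mul ha hM.le hp.le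
      _ ≤ _ := by
        gcongr
        have : 1 ≤ 16 * a ^ 2 := by nlinarith
        have hMp : 0 < M ^ p := by positivity
        nlinarith

/-- If the energy is bounded and the `L²` norm is small, then the energy of the truncation at level
`1 / 4` is small on a smaller cylinder. -/
theorem exists_energyBound_small (hd : 1 ≤ d) {γ₁ γ₂ γ₃ p : ℝ}
    (hγ₁ : 0 < γ₁) (hγ₂ : 0 < γ₂) (hγ₃ : 0 < γ₃) (hp : 1 ≤ p) (hp2 : p < 2 + 4 / (d : ℝ))
    {K ε : ℝ} (hK : 0 < K) (hε : 0 < ε) :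
    ∃ δ : ℝ, 0 < δ ∧ ∀ (u : ℝ × 𝔼 → ℝ) (G₀ G₁ : ℝ × 𝔼 → 𝔼), Measurable u →
      HasL2SpatialGradient (spaceTimeCylinder d 1) (fun z => max (u z - 0) 0) G₀ →
      EnergyBound (fun z => max (u z - 0) 0) G₀ (3 / 4) K →
      LevelEnergy γ₁ γ₂ γ₃ p u (1 / 4) G₁ →
      ∫⁻ z in spaceTimeCylinder d 1, ENNReal.ofReal (max (u z - 0) 0 ^ 2) ≤ ENNReal.ofReal δ →
      EnergyBound (fun z => max (u z - 1 / 4) 0) G₁ (5 / 8) ε := by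
  have hp0 : 0 < p := by linarith
  obtain ⟨C, hC, HC⟩ := exists_lintegral_rpow_truncation_le hd hp0 hp2
  set c₁ : ℝ := (1 + 1 / γ₁) * (2 + γ₂ + γ₃) with hc₁
  have hc₁0 : 0 < c₁ := by positivity
  set κ : ℝ := 2 + 4 / (d : ℝ) - p with hκ
  have hκ0 : 0 < κ := sub_pos.2 hp2
  -- The `L^p` budget, for which `c₁ * β ^ (1 / p) = ε / 2`. Next `M` is taken so large that the
  -- part above `M` uses half of it, and `δ` so small that the part below uses the other half.
  set β : ℝ := (ε / (2 * c₁)) ^ p with hβ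
  have hβ0 : 0 < β := by positivity
  set Y : ℝ := 2 ^ p * (C * K ^ (1 + 2 / (d : ℝ)) * 256) with hY
  have hY0 : 0 < Y := by positivity
  set M : ℝ := (2 * Y / β) ^ (1 / κ) with hM
  have hM0 : 0 < M := by positivity
  have hMκ : M ^ (p - 2 - 4 / (d : ℝ)) = β / (2 * Y) := by
    have e : p - 2 - 4 / (d : ℝ) = -κ := by rw [hκ]; ring
    rw [e, Real.rpow_neg hM0.le, hM, ← Real.rpow_mul (by positivity), one_div_mul_cancel hκ0.ne',
      Real.rpow_one, inv_div]
  set Z : ℝ := 2 ^ p * (16 * M ^ p) with hZ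
  have hZ0 : 0 < Z := by positivity
  refine ⟨min (ε / (512 * c₁)) (β / (2 * Z)), by positivity, ?_⟩
  intro u G₀ G₁ hu hG₀ hEB hL hsq
  set δ : ℝ := min (ε / (512 * c₁)) (β / (2 * Z)) with hδ
  have hδ0 : 0 < δ := by positivity
  have hsq' : ∫⁻ z in spaceTimeCylinder d (11 / 16), ENNReal.ofReal (max (u z - 0) 0 ^ 2)
      ≤ ENNReal.ofReal δ := (lintegral_mono_set (spaceTimeCylinder_mono (by norm_num))).trans hsq
  have hA : ∫⁻ z in spaceTimeCylinder d (11 / 16), ENNReal.ofReal (max (u z - 1 / 4) 0 ^ 2)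
      ≤ ENNReal.ofReal δ := by
    refine le_trans (lintegral_mono fun z => ENNReal.ofReal_le_ofReal ?_) hsq'
    gcongr
    norm_num
  have hHC := HC _ G₀ (11 / 16) (3 / 4) K M hEB (by fun_prop) (fun z => le_max_right _ _)
    (hG₀.mono (measurableSet_spaceTimeCylinder 1) (spaceTimeCylinder_mono (by norm_num)))
    (by norm_num) (by norm_num) (by norm_num) hK hM0
  have hB : ∫⁻ z in spaceTimeCylinder d (11 / 16), ENNReal.ofReal (max (u z - 1 / 4) 0 ^ p)
      ≤ ENNReal.ofReal β := by
    calc _ ≤ ∫⁻ z in spaceTimeCylinder d (11 / 16), ENNReal.ofReal (2 ^ p) *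
          (ENNReal.ofReal (max (max (u z - 0) 0 - M) 0 ^ p)
            + ENNReal.ofReal (16 * M ^ p) * ENNReal.ofReal (max (u z - 0) 0 ^ 2)) := by
          refine lintegral_mono fun z => ?_
          rw [← ENNReal.ofReal_mul (by positivity), ← ENNReal.ofReal_add (by positivity) (by positivity),
            ← ENNReal.ofReal_mul (by positivity)]
          exact ENNReal.ofReal_le_ofReal (rpow_truncation_le hp0 hM0)
      _ = ENNReal.ofReal (2 ^ p) *
          ((∫⁻ z in spaceTimeCylinder d (11 / 16), ENNReal.ofReal (max (max (u z - 0) 0 - M) 0 ^ p))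
            + ENNReal.ofReal (16 * M ^ p) *
              ∫⁻ z in spaceTimeCylinder d (11 / 16), ENNReal.ofReal (max (u z - 0) 0 ^ 2)) := by
          rw [lintegral_const_mul' _ _ ENNReal.ofReal_ne_top, lintegral_add_left (by fun_prop),
            lintegral_const_mul' _ _ ENNReal.ofReal_ne_top]
      _ ≤ ENNReal.ofReal (2 ^ p) *
          (ENNReal.ofReal (C * M ^ (p - 2 - 4 / (d : ℝ)) * K ^ (1 + 2 / (d : ℝ)) / (3 / 4 - 11 / 16) ^ 2)
            + ENNReal.ofReal (16 * M ^ p) * ENNReal.ofReal δ) := by gcongr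
      _ ≤ ENNReal.ofReal β := by
          rw [← ENNReal.ofReal_mul (by positivity), ← ENNReal.ofReal_add (by positivity) (by positivity),
            ← ENNReal.ofReal_mul (by positivity), hMκ]
          refine ENNReal.ofReal_le_ofReal ?_
          have e1 : 2 ^ p * (C * (β / (2 * Y)) * K ^ (1 + 2 / (d : ℝ)) / (3 / 4 - 11 / 16) ^ 2)
              = β / 2 := by
            calc _ = Y * (β / (2 * Y)) := by rw [hY]; ring
              _ = β / 2 := by field_simp
          have e2 : 2 ^ p * (16 * M ^ p * δ) ≤ β / 2 := by
            calc _ = Z * δ := by rw [hZ]; ring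
              _ ≤ Z * (β / (2 * Z)) := by gcongr; exact min_le_right _ _
              _ = β / 2 := by field_simp
          rw [mul_add, e1]
          linarith
  refine (hL.energyBound hγ₁ hγ₂ hγ₃ hp hu (r := 5 / 8) (R := 11 / 16) (by norm_num) (by norm_num)
    (by norm_num) hδ0 hβ0.le hA hB).mono le_rfl ?_
  have e3 : β ^ (1 / p) = ε / (2 * c₁) := by
    rw [hβ, ← Real.rpow_mul (by positivity), mul_one_div_cancel hp0.ne', Real.rpow_one]
  rw [e3]
  have e4 : δ ≤ ε / (512 * c₁) := min_le_left _ _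
  calc c₁ * (δ / (11 / 16 - 5 / 8) ^ 2 + ε / (2 * c₁))
      ≤ c₁ * (ε / (512 * c₁) / (11 / 16 - 5 / 8) ^ 2 + ε / (2 * c₁)) := by gcongr
    _ = ε := by field_simp; norm_num

/-! ### The De Giorgi iteration. -/

/-- One step of the De Giorgi iteration. -/
theorem exists_energyBound_step (hd : 1 ≤ d) {γ₁ γ₂ γ₃ p : ℝ}
    (hγ₁ : 0 < γ₁) (hγ₂ : 0 < γ₂) (hγ₃ : 0 < γ₃) (hp : 1 ≤ p) (hp2 : p < 2 + 4 / (d : ℝ)) :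
    ∃ D : ℝ, 0 < D ∧ ∀ (u : ℝ × 𝔼 → ℝ) (k x : ℝ) (G G' : ℝ × 𝔼 → 𝔼) (E : ℝ), Measurable u →
      0 < x → x ≤ 1 →
      HasL2SpatialGradient (spaceTimeCylinder d 1) (fun z => max (u z - k) 0) G →
      EnergyBound (fun z => max (u z - k) 0) G (1 / 2 + x / 8) E →
      LevelEnergy γ₁ γ₂ γ₃ p u (k + x / 8) G' → 0 < E → E ≤ 1 →
      EnergyBound (fun z => max (u z - (k + x / 8)) 0) G' (1 / 2 + x / 16)
        (D * (1 / x) ^ 8 * E ^ ((1 + 2 / (d : ℝ)) / p)) := by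
  have hp0 : 0 < p := by linarith
  have hd1 : (1 : ℝ) ≤ d := by exact_mod_cast hd
  have hd4 : 4 / (d : ℝ) ≤ 4 := by
    rw [div_le_iff₀ (by linarith)]; linarith
  have hd40 : 0 < 4 / (d : ℝ) := by positivity
  obtain ⟨C₂, hC₂, H₂⟩ := exists_lintegral_rpow_truncation_le hd (q := 2) (by norm_num) (by linarith)
  obtain ⟨Cp, hCp, Hp⟩ := exists_lintegral_rpow_truncation_le hd hp0 hp2
  set c₁ : ℝ := (1 + 1 / γ₁) * (2 + γ₂ + γ₃) with hc₁
  have hc₁0 : 0 < c₁ := by positivity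
  refine ⟨c₁ * (C₂ * 8 ^ 4 * 32 ^ 4 + (Cp * 8 ^ 6 * 32 ^ 2) ^ (1 / p)), by positivity, ?_⟩
  intro u k x G G' E hu hx0 hx1 hG hEB hL hE0 hE1
  set F : ℝ := E ^ (1 + 2 / (d : ℝ)) with hF
  have hF0 : 0 < F := by positivity
  have hc0 : 0 < x / 8 := by positivity
  have h8x : 1 ≤ 8 / x := by rw [one_le_div hx0]; linarith
  have hx1' : 1 ≤ 1 / x := by rw [one_le_div hx0]; exact hx1
  have hpow : ∀ {a : ℝ} {m : ℕ}, -(m : ℝ) ≤ a → (x / 8) ^ a ≤ (8 / x) ^ m := by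
    intro a m ham
    have e : x / 8 = (8 / x)⁻¹ := (inv_div _ _).symm
    rw [e, Real.inv_rpow (by positivity), ← Real.rpow_neg (by positivity), ← Real.rpow_natCast]
    exact Real.rpow_le_rpow_of_exponent_le h8x (by linarith)
  have hG' := hG.mono (measurableSet_spaceTimeCylinder 1)
    (spaceTimeCylinder_mono (d := d) (r := 1 / 2 + x / 8) (R := 1) (by linarith))
  have gap : 1 / 2 + x / 8 - (1 / 2 + 3 * x / 32) = x / 32 := by ring
  have gap' : 1 / 2 + 3 * x / 32 - (1 / 2 + x / 16) = x / 32 := by ring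
  have htr : ∀ z, max (max (u z - k) 0 - x / 8) 0 = max (u z - (k + x / 8)) 0 := by
    intro z
    rcases le_total (u z - k) 0 with h | h
    · rw [max_eq_right h, max_eq_right (by linarith), max_eq_right (by linarith)]
    · rw [max_eq_left h]; ring_nf
  have key : ∀ {q C : ℝ} {m : ℕ}, 0 < C → -(m : ℝ) ≤ q - 2 - 4 / (d : ℝ) →
      ∫⁻ z in spaceTimeCylinder d (1 / 2 + 3 * x / 32),
        ENNReal.ofReal (max (max (u z - k) 0 - x / 8) 0 ^ q) ≤
          ENNReal.ofReal (C * (x / 8) ^ (q - 2 - 4 / (d : ℝ)) * F / (1 / 2 + x / 8 - (1 / 2 + 3 * x / 32)) ^ 2) →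
      ∫⁻ z in spaceTimeCylinder d (1 / 2 + 3 * x / 32),
        ENNReal.ofReal (max (u z - (k + x / 8)) 0 ^ q) ≤
          ENNReal.ofReal (C * 8 ^ m * 32 ^ 2 * (1 / x) ^ (m + 2) * F) := by
    intro q C m hC hm h
    simp only [htr] at h
    refine h.trans (ENNReal.ofReal_le_ofReal ?_)
    rw [gap]
    calc _ ≤ C * (8 / x) ^ m * F / (x / 32) ^ 2 := by gcongr; exact hpow hm
      _ = _ := by
        rw [div_pow, div_pow, div_pow]
        field_simp
        ring
  have hA := H₂ _ G (1 / 2 + 3 * x / 32) (1 / 2 + x / 8) E (x / 8) hEB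
    (by fun_prop) (fun z => le_max_right _ _) hG' (by positivity) (by linarith) (by linarith) hE0 hc0
  -- The integers `4` and `6` bound the negative exponents of the level increment from above, using
  -- `4 / d ≤ 4`. They are chosen so that both terms end with the factor `(1 / x) ^ 8`.
  replace hA := key (m := 4) hC₂ (by push_cast; linarith) hA
  have hB := key (m := 6) hCp (by push_cast; linarith)
    (Hp _ G (1 / 2 + 3 * x / 32) (1 / 2 + x / 8) E (x / 8) hEB
      (by fun_prop) (fun z => le_max_right _ _) hG' (by positivity) (by linarith) (by linarith) hE0 hc0)
  simp only [Real.rpow_two] at hA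
  refine (hL.energyBound hγ₁ hγ₂ hγ₃ hp hu (r := 1 / 2 + x / 16) (R := 1 / 2 + 3 * x / 32)
    (by positivity) (by linarith) (by linarith) (by positivity) (by positivity) hA hB).mono le_rfl ?_
  rw [gap', ← hc₁]
  set T : ℝ := E ^ ((1 + 2 / (d : ℝ)) / p) with hT
  have hT0 : 0 < T := by positivity
  -- Since `E ≤ 1` and `p ≥ 1`, the `L^p` term has the weaker power and dominates.
  have hFT : F ≤ T := by
    refine Real.rpow_le_rpow_of_exponent_ge hE0 hE1 ?_
    exact div_le_self (by positivity) hp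
  have hFp : F ^ (1 / p) = T := by
    rw [hF, ← Real.rpow_mul hE0.le, mul_one_div]
  have h1 : C₂ * 8 ^ 4 * 32 ^ 2 * (1 / x) ^ (4 + 2) * F / (x / 32) ^ 2
      ≤ C₂ * 8 ^ 4 * 32 ^ 4 * (1 / x) ^ 8 * T := by
    have e : 1 / (x / 32) ^ 2 = 32 ^ 2 * (1 / x) ^ 2 := by field_simp
    calc _ = C₂ * 8 ^ 4 * 32 ^ 4 * (1 / x) ^ 8 * F := by rw [div_eq_mul_one_div, e]; ring
      _ ≤ _ := by gcongr
  have h2 : (Cp * 8 ^ 6 * 32 ^ 2 * (1 / x) ^ (6 + 2) * F) ^ (1 / p)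
      ≤ (Cp * 8 ^ 6 * 32 ^ 2) ^ (1 / p) * (1 / x) ^ 8 * T := by
    rw [Real.mul_rpow (by positivity) hF0.le, Real.mul_rpow (by positivity) (by positivity), hFp]
    gcongr
    calc ((1 / x) ^ (6 + 2)) ^ (1 / p) ≤ ((1 / x) ^ (6 + 2)) ^ (1 : ℝ) :=
          Real.rpow_le_rpow_of_exponent_le (one_le_pow₀ hx1') (by rw [div_le_one hp0]; exact hp)
      _ = _ := Real.rpow_one _
  calc _ ≤ c₁ * (C₂ * 8 ^ 4 * 32 ^ 4 * (1 / x) ^ 8 * T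
        + (Cp * 8 ^ 6 * 32 ^ 2) ^ (1 / p) * (1 / x) ^ 8 * T) := by gcongr
    _ = _ := by ring

/-- Fast geometric convergence. -/
theorem exists_geometric_decay {D β : ℝ} (hD : 0 < D) (hβ : 0 < β) :
    ∃ E lam : ℝ, 0 < E ∧ 0 < lam ∧ lam < 1 ∧ ∀ P : ℕ → ℝ → Prop,
      (∀ n e e', e ≤ e' → P n e → P n e') →
      (∀ n e, 0 < e → e ≤ 1 → P n e → P (n + 1) (D * 256 ^ n * e ^ (1 + β))) →
      P 0 E → ∀ n, P n (E * lam ^ n) := by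
  -- Chosen so that `lam ^ β = 1 / 256` cancels the growth `256 ^ n`; then `E` is chosen with `D * E
  -- ^ β ≤ lam`.
  set lam : ℝ := 256 ^ (-(1 / β)) with hlam
  have hl0 : 0 < lam := by positivity
  have hl1 : lam < 1 := Real.rpow_lt_one_of_one_lt_of_neg (by norm_num) (by
    have := one_div_pos.2 hβ; linarith)
  have hlβ : lam ^ β = 1 / 256 := by
    rw [hlam, ← Real.rpow_mul (by norm_num), neg_mul, one_div_mul_cancel hβ.ne', Real.rpow_neg_one,
      one_div]
  set E : ℝ := min 1 ((lam / D) ^ (1 / β)) with hE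
  have hE0 : 0 < E := by positivity
  have hEβ : D * E ^ β ≤ lam := by
    have : E ^ β ≤ lam / D := by
      calc E ^ β ≤ ((lam / D) ^ (1 / β)) ^ β := Real.rpow_le_rpow hE0.le (min_le_right _ _) hβ.le
        _ = lam / D := by
          rw [← Real.rpow_mul (by positivity), one_div_mul_cancel hβ.ne', Real.rpow_one]
    rw [le_div_iff₀ hD] at this
    linarith
  refine ⟨E, lam, hE0, hl0, hl1, fun P hmono hstep h0 n => ?_⟩
  induction n with
  | zero => simpa using h0
  | succ n ih =>
    have hle : E * lam ^ n ≤ 1 := mul_le_one₀ (min_le_left _ _) (by positivity) (pow_le_one₀ hl0.le hl1.le)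
    refine hmono _ _ _ ?_ (hstep n _ (by positivity) hle ih)
    have e1 : (lam ^ n) ^ β = (1 / 256) ^ n := by
      rw [← Real.rpow_natCast lam, ← Real.rpow_mul hl0.le, mul_comm, Real.rpow_mul hl0.le, hlβ,
        Real.rpow_natCast]
    have e2 : (256 : ℝ) ^ n * (1 / 256) ^ n = 1 := by rw [← mul_pow]; norm_num
    rw [Real.rpow_add (by positivity), Real.rpow_one, Real.mul_rpow hE0.le (by positivity), e1]
    calc D * 256 ^ n * (E * lam ^ n * (E ^ β * (1 / 256) ^ n))
        = (D * E ^ β) * (E * lam ^ n) * (256 ^ n * (1 / 256) ^ n) := by ring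
      _ ≤ lam * (E * lam ^ n) * 1 := by rw [e2]; gcongr
      _ = _ := by ring

/-- The truncation at level `K` lies below every truncation at level `k n`, so its `L²` norm on the
limit cylinder is zero. -/
theorem ae_le_of_energyBound_decay {u : ℝ × 𝔼 → ℝ} (hu : Measurable u) {E lam : ℝ}
    (hl0 : 0 < lam) (hl1 : lam < 1) {k ρ : ℕ → ℝ} {K r : ℝ} (hk : ∀ n, k n ≤ K) (hρ : ∀ n, r ≤ ρ n)
    (hr : r ≤ 1) {G : ℕ → ℝ × 𝔼 → 𝔼}
    (h : ∀ n, EnergyBound (fun z => max (u z - k n) 0) (G n) (ρ n) (E * lam ^ n)) :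
    ∀ᵐ z ∂(volume.restrict (spaceTimeCylinder d r)), u z ≤ K := by
  have hle : ∀ n, ∫⁻ z in spaceTimeCylinder d r, ENNReal.ofReal (max (u z - K) 0 ^ 2)
      ≤ ENNReal.ofReal (E * lam ^ n) := by
    intro n
    refine le_trans (lintegral_mono fun z => ENNReal.ofReal_le_ofReal ?_)
      (((h n).mono (hρ n) le_rfl).lintegral_sq_le (by fun_prop) hr)
    have := hk n
    gcongr
  have hlim : Filter.Tendsto (fun n : ℕ => ENNReal.ofReal (E * lam ^ n)) Filter.atTop (nhds 0) := by
    have := ENNReal.tendsto_ofReal ((tendsto_pow_atTop_nhds_zero_of_lt_one hl0.le hl1).const_mul E)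
    simpa using this
  have h0 : ∫⁻ z in spaceTimeCylinder d r, ENNReal.ofReal (max (u z - K) 0 ^ 2) = 0 :=
    le_antisymm (ge_of_tendsto' hlim hle) zero_le
  rw [lintegral_eq_zero_iff (by fun_prop)] at h0
  filter_upwards [h0] with z hz
  simp only [Pi.zero_apply, ENNReal.ofReal_eq_zero] at hz
  by_contra hcon
  push Not at hcon
  have : 0 < max (u z - K) 0 := lt_max_of_lt_left (by linarith)
  have := pow_pos this 2
  linarith

/-- The first De Giorgi lemma, for measurable representatives. -/
theorem exists_ae_le_half (hd : 1 ≤ d) {γ₁ γ₂ γ₃ p : ℝ}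
    (hγ₁ : 0 < γ₁) (hγ₂ : 0 < γ₂) (hγ₃ : 0 < γ₃) (hp : 1 ≤ p) (hp2 : p < ((d : ℝ) + 2) / d) :
    ∃ δ : ℝ, 0 < δ ∧ ∀ u : ℝ × 𝔼 → ℝ, Measurable u →
      (∀ k, ∃ G, LevelEnergy γ₁ γ₂ γ₃ p u k G) →
      (∃ M : ℝ, ∀ᵐ t ∂(volume.restrict (Ioo (-1) 0)),
        ∫⁻ x in Metric.ball (0 : 𝔼) 1, ENNReal.ofReal (max (u (t, x) - 0) 0 ^ 2) ≤ ENNReal.ofReal M) →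
      ∫⁻ z in spaceTimeCylinder d 1, ENNReal.ofReal (max (u z - 0) 0 ^ 2) ≤ ENNReal.ofReal δ →
      ∀ᵐ z ∂(volume.restrict (spaceTimeCylinder d (1 / 2))), u z ≤ 1 / 2 := by
  have hp0 : 0 < p := by linarith
  have hd0 : (0 : ℝ) < d := by exact_mod_cast hd
  have hpd : p < 1 + 2 / (d : ℝ) := by
    rwa [add_div, div_self hd0.ne'] at hp2
  have hp3 : p < 2 + 4 / (d : ℝ) := by
    have : 4 / (d : ℝ) = 2 * (2 / (d : ℝ)) := by ring
    have h0 : 0 < 2 / (d : ℝ) := by positivity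
    linarith
  set β : ℝ := (1 + 2 / (d : ℝ)) / p - 1 with hβ
  have hβ0 : 0 < β := by
    rw [hβ, sub_pos, one_lt_div hp0]; exact hpd
  obtain ⟨D, hD, hstep⟩ := exists_energyBound_step hd hγ₁ hγ₂ hγ₃ hp hp3
  obtain ⟨E, lam, hE, hl0, hl1, hdecay⟩ := exists_geometric_decay hD hβ0
  obtain ⟨K, hK, hbound⟩ := exists_energyBound_of_lintegral_sq_le hd hγ₁ hγ₂ hγ₃ hp hp3
  obtain ⟨δ, hδ, hsmall⟩ := exists_energyBound_small hd hγ₁ hγ₂ hγ₃ hp hp3 hK hE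
  refine ⟨min δ 1, by positivity, ?_⟩
  rintro u hu hlev ⟨M, hM⟩ hsq
  choose G hG using hlev
  -- A bound depending on `u`, used only to start the absorption; no constant depends on it.
  have hprior : ∃ E₀, 0 < E₀ ∧ EnergyBound (fun z => max (u z - 0) 0) (G 0) 1 E₀ := by
    have hfin : ∫⁻ z in spaceTimeCylinder d 1, ENNReal.ofReal (‖G 0 z‖ ^ 2) < ⊤ := by
      have := (hG 0).gradient.memLp.eLpNorm_lt_top
      rw [eLpNorm_lt_top_iff_lintegral_rpow_enorm_lt_top (by norm_num) (by norm_num)] at this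
      simpa [ofReal_sq_eq_enorm] using this
    set N := (∫⁻ z in spaceTimeCylinder d 1, ENNReal.ofReal (‖G 0 z‖ ^ 2)).toReal with hN
    refine ⟨max 1 (max M N), by positivity, ?_, ?_⟩
    · filter_upwards [hM] with t ht
      exact ht.trans (ENNReal.ofReal_le_ofReal (by simp))
    · rw [← ENNReal.ofReal_toReal hfin.ne]
      exact ENNReal.ofReal_le_ofReal ((le_max_right M N).trans (le_max_right _ _))
  have hsq1 := hsq.trans (ENNReal.ofReal_le_ofReal (min_le_right _ _))
  have hsqδ := hsq.trans (ENNReal.ofReal_le_ofReal (min_le_left _ _))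
  have hstart := hsmall u (G 0) (G (1 / 4)) hu (hG 0).gradient (hbound u 0 (G 0) hu (hG 0) hprior hsq1)
    (hG _) hsqδ
  set x : ℕ → ℝ := fun n => (1 / 2) ^ n with hx
  -- Levels rise from `1 / 4` to `1 / 2` while radii `1 / 2 + x n / 8` fall from `5 / 8` to `1 / 2`.
  -- With `x n = 2 ^ (-n)`, the factor `(1 / x n) ^ 8` is `256 ^ n`.
  set k : ℕ → ℝ := fun n => 1 / 2 - x n / 4 with hk
  have hx0 : ∀ n, 0 < x n := fun n => by positivity
  have hx1 : ∀ n, x n ≤ 1 := fun n => pow_le_one₀ (by norm_num) (by norm_num)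
  have hxs : ∀ n, x (n + 1) = x n / 2 := fun n => by simp only [hx, pow_succ]; ring
  have hks : ∀ n, k (n + 1) = k n + x n / 8 := fun n => by simp only [hk, hxs]; ring
  refine ae_le_of_energyBound_decay hu hl0 hl1 (k := k) (ρ := fun n => 1 / 2 + x n / 8)
    (G := fun n => G (k n)) (fun n => by have := hx0 n; simp only [hk]; linarith)
    (fun n => by have := hx0 n; linarith) (by norm_num)
    (hdecay (fun n e => EnergyBound (fun z => max (u z - k n) 0) (G (k n)) (1 / 2 + x n / 8) e)
      (fun n e e' hle h => h.mono le_rfl hle) ?_ ?_)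
  · intro n e he0 he1 h
    have := hstep u (k n) (x n) (G (k n)) (G (k (n + 1))) e hu (hx0 n) (hx1 n) (hG _).gradient h
      (by rw [← hks]; exact hG _) he0 he1
    rw [← hks] at this
    have e1 : 1 / 2 + x (n + 1) / 8 = 1 / 2 + x n / 16 := by rw [hxs]; ring
    have e2 : (256 : ℝ) ^ n = (1 / x n) ^ 8 := by
      simp only [hx, one_div, inv_pow, inv_inv]
      rw [← pow_mul, mul_comm, pow_mul]; norm_num
    have e3 : 1 + β = (1 + 2 / (d : ℝ)) / p := by rw [hβ]; ring
    rw [e1, e2, e3]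
    exact this
  · have e1 : k 0 = 1 / 4 := by simp only [hk, hx]; norm_num
    have e2 : 1 / 2 + x 0 / 8 = 5 / 8 := by simp only [hx]; norm_num
    rw [e1, e2]
    exact hstart

/-! ### Passage to a measurable representative. -/

theorem HasL2SpatialGradient.congr {Q : Set (ℝ × 𝔼)} {u v : ℝ × 𝔼 → ℝ} {G : ℝ × 𝔼 → 𝔼}
    (h : HasL2SpatialGradient Q u G) (huv : u =ᵐ[volume.restrict Q] v) :
    HasL2SpatialGradient Q v G := by
  refine ⟨h.memLp, fun φ h1 h2 h3 y => ?_⟩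
  rw [← h.integral_eq φ h1 h2 h3 y]
  refine integral_congr_ae ?_
  filter_upwards [huv] with z hz
  rw [hz]

/-- By Fubini almost every slice of `u` and `v` agrees almost everywhere. The energy inequality is
imposed at almost all times only, so it survives the change on a null set. -/
theorem DeGiorgiSubclass.exists_levelEnergy {γ₁ γ₂ γ₃ p : ℝ} {u v : ℝ × 𝔼 → ℝ}
    (h : DeGiorgiSubclass (-4) 0 (Metric.ball 0 2) γ₁ γ₂ γ₃ p u)
    (huv : u =ᵐ[volume.restrict (Ioo (-4) 0 ×ˢ Metric.ball 0 2)] v) (k : ℝ) :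
    ∃ G, LevelEnergy γ₁ γ₂ γ₃ p v k G := by
  have hQ : spaceTimeCylinder d 1 ⊆ Ioo (-4) 0 ×ˢ Metric.ball 0 2 :=
    prod_mono (Ioo_subset_Ioo_left (by norm_num)) (Metric.ball_subset_ball (by norm_num))
  have hI : Ioo (-1 : ℝ) 0 ⊆ Ioo (-4) 0 := Ioo_subset_Ioo_left (by norm_num)
  have hslice : ∀ᵐ t ∂(volume.restrict (Ioo (-4 : ℝ) 0)),
      ∀ᵐ x ∂(volume.restrict (Metric.ball (0 : 𝔼) 2)), u (t, x) = v (t, x) := by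
    rw [Measure.volume_eq_prod, ← Measure.prod_restrict] at huv
    exact Measure.ae_ae_of_ae_prod huv
  obtain ⟨G, hG, hE⟩ := h.energy k
  refine ⟨G, ?_, fun r R hr hrR hR => ?_⟩
  · refine (hG.mono (measurableSet_Ioo.prod measurableSet_ball) hQ).congr ?_
    filter_upwards [ae_mono (Measure.restrict_mono hQ le_rfl) huv] with z hz
    rw [hz]
  · have hsub : ∀ {ρ : ℝ}, ρ ≤ 1 → Metric.ball (0 : 𝔼) ρ ⊆ Metric.ball 0 2 := fun hρ =>
      Metric.ball_subset_ball (by linarith)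
    have hin : ∀ (F : ℝ → ℝ≥0∞) (ρ : ℝ), ρ ≤ 1 → ∀ᵐ t ∂(volume.restrict (Ioo (-4 : ℝ) 0)),
        ∫⁻ x in Metric.ball (0 : 𝔼) ρ, F (u (t, x)) = ∫⁻ x in Metric.ball (0 : 𝔼) ρ, F (v (t, x)) := by
      intro F ρ hρ
      filter_upwards [hslice] with t ht
      refine lintegral_congr_ae ?_
      filter_upwards [ae_mono (Measure.restrict_mono (hsub hρ) le_rfl) ht] with x hx
      rw [hx]
    have hin2 : ∀ (F : ℝ → ℝ≥0∞) (ρ : ℝ), ρ ≤ 1 → ∀ s ∈ Ioo (-4 : ℝ) 0, ∀ t ∈ Ioo (-4 : ℝ) 0,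
        ∫⁻ τ in Ioo s t, ∫⁻ x in Metric.ball (0 : 𝔼) ρ, F (u (τ, x))
          = ∫⁻ τ in Ioo s t, ∫⁻ x in Metric.ball (0 : 𝔼) ρ, F (v (τ, x)) := by
      intro F ρ hρ s hs t ht
      refine lintegral_congr_ae ?_
      exact ae_mono (Measure.restrict_mono (Ioo_subset_Ioo hs.1.le ht.2.le) le_rfl) (hin F ρ hρ)
    have hall := hE r R 0 hr hrR (by simp) (hsub hR)
    refine ae_mono (Measure.restrict_mono hI le_rfl) ?_
    filter_upwards [hall, ae_restrict_mem measurableSet_Ioo,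
      hin (fun a => ENNReal.ofReal (max (a - k) 0 ^ 2)) R hR] with s hs hsm hs2
    refine ae_mono (Measure.restrict_mono hI le_rfl) ?_
    filter_upwards [hs, ae_restrict_mem measurableSet_Ioo,
      hin (fun a => ENNReal.ofReal (max (a - k) 0 ^ 2)) r (by linarith)] with t ht htm ht2 hst
    have := ht hst
    unfold EnergyInequality at this ⊢
    rw [← hs2, ← ht2, ← hin2 (fun a => ENNReal.ofReal (max (a - k) 0 ^ 2)) R hR s hsm t htm,
      ← hin2 (fun a => ENNReal.ofReal (max (a - k) 0 ^ p)) R hR s hsm t htm]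
    exact this

theorem MemLinftyL2.exists_slice_bound {u v : ℝ × 𝔼 → ℝ}
    (h : MemLinftyL2 (-4) 0 (Metric.ball 0 2) u)
    (huv : u =ᵐ[volume.restrict (Ioo (-4) 0 ×ˢ Metric.ball 0 2)] v) :
    ∃ M : ℝ, ∀ᵐ t ∂(volume.restrict (Ioo (-1) 0)),
      ∫⁻ x in Metric.ball (0 : 𝔼) 1, ENNReal.ofReal (max (v (t, x) - 0) 0 ^ 2) ≤ ENNReal.ofReal M := by
  have hslice : ∀ᵐ t ∂(volume.restrict (Ioo (-4 : ℝ) 0)),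
      ∀ᵐ x ∂(volume.restrict (Metric.ball (0 : 𝔼) 2)), u (t, x) = v (t, x) := by
    rw [Measure.volume_eq_prod, ← Measure.prod_restrict] at huv
    exact Measure.ae_ae_of_ae_prod huv
  obtain ⟨M, hM⟩ := h.bounded
  refine ⟨max M 0 ^ 2, ?_⟩
  refine ae_mono (Measure.restrict_mono (Ioo_subset_Ioo_left (by norm_num : (-4 : ℝ) ≤ -1)) le_rfl) ?_
  filter_upwards [hslice, hM] with t ht hMt
  have hsub : Metric.ball (0 : 𝔼) 1 ⊆ Metric.ball 0 2 := Metric.ball_subset_ball (by norm_num)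
  calc ∫⁻ x in Metric.ball (0 : 𝔼) 1, ENNReal.ofReal (max (v (t, x) - 0) 0 ^ 2)
      ≤ ∫⁻ x in Metric.ball (0 : 𝔼) 2, ENNReal.ofReal (max (v (t, x) - 0) 0 ^ 2) :=
        lintegral_mono_set hsub
    _ ≤ ∫⁻ x in Metric.ball (0 : 𝔼) 2, ‖u (t, x)‖ₑ ^ 2 := by
        refine lintegral_mono_ae ?_
        filter_upwards [ht] with x hx
        rw [← ofReal_sq_eq_enorm, hx, sub_zero]
        refine ENNReal.ofReal_le_ofReal ?_
        rw [sq_le_sq, abs_of_nonneg (le_max_right _ _)]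
        exact max_le (le_abs_self _) (abs_nonneg _)
    _ = eLpNorm (fun x => u (t, x)) 2 (volume.restrict (Metric.ball 0 2)) ^ 2 := by
        rw [eLpNorm_eq_lintegral_rpow_enorm_toReal (by norm_num) (by norm_num), ← ENNReal.rpow_natCast,
          ← ENNReal.rpow_mul]
        norm_num
    _ ≤ ENNReal.ofReal (max M 0) ^ 2 := by
        gcongr
        exact hMt.trans (ENNReal.ofReal_le_ofReal (le_max_left _ _))
    _ = _ := (ENNReal.ofReal_pow (le_max_right _ _) 2).symm

theorem parabolicCylinder_one : parabolicCylinder d 1 = spaceTimeCylinder d 1 := by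
  simp [parabolicCylinder, spaceTimeCylinder]

/-- The time intervals are `(-1 / 4, 0)` and `(-1 / 2, 0)`. -/
theorem parabolicCylinder_half_subset : parabolicCylinder d (1 / 2) ⊆ spaceTimeCylinder d (1 / 2) :=
  prod_mono (Ioo_subset_Ioo_left (by norm_num)) le_rfl

theorem exists_positivePart_le_half (hd : 1 ≤ d) {γ₁ γ₂ γ₃ p : ℝ}
    (hγ₁ : 0 < γ₁) (hγ₂ : 0 < γ₂) (hγ₃ : 0 < γ₃) (hp : 1 ≤ p) (hp2 : p < ((d : ℝ) + 2) / d) :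
    ∃ δ : ℝ, 0 < δ ∧ ∀ u : ℝ × 𝔼 → ℝ,
      DeGiorgiSubclass (-4) 0 (Metric.ball 0 2) γ₁ γ₂ γ₃ p u →
      (∫⁻ z in parabolicCylinder d 1, ENNReal.ofReal (max (u z) 0 ^ 2)) ≤ ENNReal.ofReal δ →
      ∀ᵐ z ∂(volume.restrict (parabolicCylinder d (1 / 2))), max (u z) 0 ≤ 1 / 2 := by
  obtain ⟨δ, hδ, H⟩ := exists_ae_le_half hd hγ₁ hγ₂ hγ₃ hp hp2
  refine ⟨δ, hδ, fun u hu hsq => ?_⟩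
  set v := hu.memLinftyL2.aestronglyMeasurable.aemeasurable.mk with hv
  have huv : u =ᵐ[volume.restrict (Ioo (-4) 0 ×ˢ Metric.ball 0 2)] v :=
    hu.memLinftyL2.aestronglyMeasurable.aemeasurable.ae_eq_mk
  have hvm : Measurable v := hu.memLinftyL2.aestronglyMeasurable.aemeasurable.measurable_mk
  have hsub : ∀ {r : ℝ}, r ≤ 1 → spaceTimeCylinder d r ⊆ Ioo (-4) 0 ×ˢ Metric.ball 0 2 := fun hr =>
    prod_mono (Ioo_subset_Ioo_left (by linarith)) (Metric.ball_subset_ball (by linarith))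
  have key := H v hvm (hu.exists_levelEnergy huv) (hu.memLinftyL2.exists_slice_bound huv) ?_
  · refine ae_mono (Measure.restrict_mono parabolicCylinder_half_subset le_rfl) ?_
    filter_upwards [key, ae_mono (Measure.restrict_mono (hsub (by norm_num)) le_rfl) huv] with z hz1 hz2
    rw [hz2]
    exact max_le hz1 (by norm_num)
  · rw [parabolicCylinder_one] at hsq
    refine le_trans (le_of_eq (lintegral_congr_ae ?_)) hsq
    filter_upwards [ae_mono (Measure.restrict_mono (hsub le_rfl) le_rfl) huv] with z hz
    rw [hz, sub_zero]

/-! ### Scaling and the `L²`–`L^∞` estimate. -/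

theorem HasL2SpatialGradient.const_mul {Q : Set (ℝ × 𝔼)} {u : ℝ × 𝔼 → ℝ} {G : ℝ × 𝔼 → 𝔼}
    (h : HasL2SpatialGradient Q u G) (c : ℝ) :
    HasL2SpatialGradient Q (fun z => c * u z) (fun z => c • G z) := by
  refine ⟨h.memLp.const_smul c, fun φ h1 h2 h3 y => ?_⟩
  simp only [mul_assoc, inner_smul_left, conj_trivial]
  rw [integral_const_mul, integral_const_mul, h.integral_eq φ h1 h2 h3 y, mul_neg]

theorem max_mul_sub_eq {c : ℝ} (hc : 0 < c) (a k : ℝ) :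
    max (c * a - k) 0 = c * max (a - k / c) 0 := by
  rw [mul_max_of_nonneg _ _ hc.le, mul_zero, mul_sub, mul_div_cancel₀ _ hc.ne']

/-- The quadratic terms scale by `c ^ 2` and the `L^p` term by `c`, so `c ^ 2 ≤ c` is what is
needed. The restriction to `c ≤ 1` is the source of the `+ 1` in the final estimate. -/
theorem EnergyInequality.const_mul {γ₁ γ₂ γ₃ p : ℝ} (hp : 1 ≤ p) {u : ℝ × 𝔼 → ℝ} {k c : ℝ}
    (hc : 0 < c) (hc1 : c ≤ 1) {G : ℝ × 𝔼 → 𝔼} {x₀ : 𝔼} {r R s t : ℝ}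
    (h : EnergyInequality γ₁ γ₂ γ₃ p u (k / c) G x₀ r R s t) :
    EnergyInequality γ₁ γ₂ γ₃ p (fun z => c * u z) k (fun z => c • G z) x₀ r R s t := by
  have hp0 : 0 < p := by linarith
  have e2 : ∀ z, ENNReal.ofReal (max (c * u z - k) 0 ^ 2)
      = ENNReal.ofReal (c ^ 2) * ENNReal.ofReal (max (u z - k / c) 0 ^ 2) := fun z => by
    rw [max_mul_sub_eq hc, mul_pow, ENNReal.ofReal_mul (by positivity)]
  have ep : ∀ z, ENNReal.ofReal (max (c * u z - k) 0 ^ p)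
      = ENNReal.ofReal (c ^ p) * ENNReal.ofReal (max (u z - k / c) 0 ^ p) := fun z => by
    rw [max_mul_sub_eq hc, Real.mul_rpow hc.le (le_max_right _ _), ENNReal.ofReal_mul (by positivity)]
  have eG : ∀ z, ENNReal.ofReal (‖c • G z‖ ^ 2)
      = ENNReal.ofReal (c ^ 2) * ENNReal.ofReal (‖G z‖ ^ 2) := fun z => by
    rw [norm_smul, Real.norm_eq_abs, abs_of_pos hc, mul_pow, ENNReal.ofReal_mul (by positivity)]
  unfold EnergyInequality at h ⊢
  simp only [e2, ep, eG, lintegral_const_mul' _ _ ENNReal.ofReal_ne_top]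
  set a := ENNReal.ofReal (c ^ 2) with ha
  have hroot : ENNReal.ofReal (c ^ p) ^ (1 / p) = ENNReal.ofReal c := by
    rw [ENNReal.ofReal_rpow_of_pos (by positivity), ← Real.rpow_mul hc.le, mul_one_div_cancel hp0.ne',
      Real.rpow_one]
  rw [ENNReal.mul_rpow_of_nonneg _ _ (by positivity), hroot]
  have hac : a ≤ ENNReal.ofReal c := ENNReal.ofReal_le_ofReal (by nlinarith)
  set I₁ := ∫⁻ x in Metric.ball x₀ r, ENNReal.ofReal (max (u (t, x) - k / c) 0 ^ 2)
  set I₂ := ∫⁻ τ in Ioo s t, ∫⁻ x in Metric.ball x₀ r, ENNReal.ofReal (‖G (τ, x)‖ ^ 2)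
  set I₃ := ∫⁻ x in Metric.ball x₀ R, ENNReal.ofReal (max (u (s, x) - k / c) 0 ^ 2)
  set I₄ := ∫⁻ τ in Ioo s t, ∫⁻ x in Metric.ball x₀ R, ENNReal.ofReal (max (u (τ, x) - k / c) 0 ^ 2)
  set I₅ := (∫⁻ τ in Ioo s t, ∫⁻ x in Metric.ball x₀ R,
    ENNReal.ofReal (max (u (τ, x) - k / c) 0 ^ p)) ^ (1 / p)
  calc a * I₁ + ENNReal.ofReal γ₁ * (a * I₂) = a * (I₁ + ENNReal.ofReal γ₁ * I₂) := by ring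
    _ ≤ a * (I₃ + ENNReal.ofReal (γ₂ / (R - r) ^ 2) * I₄ + ENNReal.ofReal γ₃ * I₅) := by gcongr
    _ = a * I₃ + ENNReal.ofReal (γ₂ / (R - r) ^ 2) * (a * I₄) + ENNReal.ofReal γ₃ * (a * I₅) := by ring
    _ ≤ _ := by gcongr

/-- The De Giorgi sub-class is stable under multiplication by constants in `(0, 1]`. -/
theorem DeGiorgiSubclass.const_mul {T₁ T₂ : ℝ} {Ω : Set 𝔼} {γ₁ γ₂ γ₃ p : ℝ} (hp : 1 ≤ p)
    {u : ℝ × 𝔼 → ℝ} (h : DeGiorgiSubclass T₁ T₂ Ω γ₁ γ₂ γ₃ p u) {c : ℝ} (hc : 0 < c) (hc1 : c ≤ 1) :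
    DeGiorgiSubclass T₁ T₂ Ω γ₁ γ₂ γ₃ p (fun z => c * u z) := by
  refine ⟨⟨h.memLinftyL2.aestronglyMeasurable.const_mul c, ?_⟩, ?_, fun k => ?_⟩
  · obtain ⟨M, hM⟩ := h.memLinftyL2.bounded
    refine ⟨M, ?_⟩
    filter_upwards [hM] with t ht
    refine le_trans (eLpNorm_mono fun x => ?_) ht
    rw [norm_mul, Real.norm_eq_abs c, abs_of_pos hc]
    exact mul_le_of_le_one_left (norm_nonneg _) hc1
  · obtain ⟨G, hG⟩ := h.exists_gradient
    exact ⟨_, hG.const_mul c⟩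
  · obtain ⟨G, hG, hE⟩ := h.energy (k / c)
    refine ⟨fun z => c • G z, ?_, fun r R x₀ hr hrR hx₀ hR => ?_⟩
    · simpa only [max_mul_sub_eq hc] using hG.const_mul c
    · filter_upwards [hE r R x₀ hr hrR hx₀ hR] with s hs
      filter_upwards [hs] with t ht hst
      exact (ht hst).const_mul hp hc hc1

theorem eLpNorm_two_sq_eq_lintegral {α : Type*} [MeasurableSpace α] (μ : Measure α) (f : α → ℝ) :
    eLpNorm f 2 μ ^ 2 = ∫⁻ a, ENNReal.ofReal (f a ^ 2) ∂μ := by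
  rw [eLpNorm_eq_lintegral_rpow_enorm_toReal (by norm_num) (by norm_num), ← ENNReal.rpow_natCast,
    ← ENNReal.rpow_mul]
  norm_num [ofReal_sq_eq_enorm]

/-- The local `L²`–`L^∞` estimate follows from the smallness statement by scaling. -/
theorem eLpNorm_top_le_of_smallness {γ₁ γ₂ γ₃ p δ : ℝ} (hp : 1 ≤ p) (hδ : 0 < δ)
    (H : ∀ u : ℝ × 𝔼 → ℝ, DeGiorgiSubclass (-4) 0 (Metric.ball 0 2) γ₁ γ₂ γ₃ p u →
      (∫⁻ z in parabolicCylinder d 1, ENNReal.ofReal (max (u z) 0 ^ 2)) ≤ ENNReal.ofReal δ →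
      ∀ᵐ z ∂(volume.restrict (parabolicCylinder d (1 / 2))), max (u z) 0 ≤ 1 / 2)
    {u : ℝ × 𝔼 → ℝ} (hu : DeGiorgiSubclass (-4) 0 (Metric.ball 0 2) γ₁ γ₂ γ₃ p u) :
    eLpNorm (fun z => max (u z) 0) ⊤ (volume.restrict (parabolicCylinder d (1 / 2))) ≤
      ENNReal.ofReal (1 + 1 / √δ) *
        (eLpNorm (fun z => max (u z) 0) 2 (volume.restrict (parabolicCylinder d 1)) + 1) := by
  set N := eLpNorm (fun z => max (u z) 0) 2 (volume.restrict (parabolicCylinder d 1)) with hN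
  have hsδ : 0 < √δ := Real.sqrt_pos.2 hδ
  by_cases htop : N = ⊤
  · rw [htop, top_add, ENNReal.mul_top (ENNReal.ofReal_pos.2 (by positivity)).ne']
    exact le_top
  set n := N.toReal with hn
  have hn0 : 0 ≤ n := ENNReal.toReal_nonneg
  have hNn : N = ENNReal.ofReal n := (ENNReal.ofReal_toReal htop).symm
  -- Both requirements on the factor `lam⁻¹` are met: it is at most `1`, and `n / lam ≤ √δ`.
  set lam : ℝ := 1 + n / √δ with hlam
  have hl1 : 1 ≤ lam := le_add_of_nonneg_right (by positivity)
  have hl0 : 0 < lam := by linarith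
  have hc0 : 0 < lam⁻¹ := inv_pos.2 hl0
  have hmax : ∀ z, max (lam⁻¹ * u z) 0 = lam⁻¹ * max (u z) 0 := fun z => by
    rw [mul_max_of_nonneg _ _ hc0.le, mul_zero]
  have key := H (fun z => lam⁻¹ * u z) (hu.const_mul hp hc0 (inv_le_one_of_one_le₀ hl1)) ?_
  · have hbound : ∀ᵐ z ∂(volume.restrict (parabolicCylinder d (1 / 2))), ‖max (u z) 0‖ ≤ lam / 2 := by
      filter_upwards [key] with z hz
      rw [hmax, inv_mul_le_iff₀ hl0] at hz
      rw [Real.norm_eq_abs, abs_of_nonneg (le_max_right _ _)]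
      linarith
    rw [eLpNorm_exponent_top]
    refine (eLpNormEssSup_le_of_ae_bound hbound).trans ?_
    rw [hNn, ← ENNReal.ofReal_one, ← ENNReal.ofReal_add hn0 zero_le_one,
      ← ENNReal.ofReal_mul (by positivity)]
    refine ENNReal.ofReal_le_ofReal ?_
    have h1 : (1 + 1 / √δ) * (n + 1) = 1 + n / √δ + (n + 1 / √δ) := by ring
    have h2 : 0 ≤ n + 1 / √δ := by positivity
    rw [h1, hlam]
    linarith
  · have e : ∫⁻ z in parabolicCylinder d 1, ENNReal.ofReal (max (lam⁻¹ * u z) 0 ^ 2)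
        = ENNReal.ofReal (lam⁻¹ ^ 2) * N ^ 2 := by
      rw [hN, eLpNorm_two_sq_eq_lintegral, ← lintegral_const_mul' _ _ ENNReal.ofReal_ne_top]
      congr 1 with z
      rw [hmax, mul_pow, ENNReal.ofReal_mul (by positivity)]
    rw [e, hNn, ← ENNReal.ofReal_pow hn0, ← ENNReal.ofReal_mul (by positivity)]
    refine ENNReal.ofReal_le_ofReal ?_
    have h1 : n / lam ≤ √δ := by
      rw [div_le_iff₀ hl0, hlam, mul_add, mul_div_cancel₀ _ hsδ.ne']
      linarith
    calc lam⁻¹ ^ 2 * n ^ 2 = (n / lam) ^ 2 := by ring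
      _ ≤ √δ ^ 2 := by gcongr
      _ = δ := Real.sq_sqrt hδ.le

end DeGiorgi

theorem lemma3p8 (d : ℕ) (hd : 1 ≤ d) (γ₁ γ₂ γ₃ p : ℝ)
    (hγ₁ : 0 < γ₁) (hγ₂ : 0 < γ₂) (hγ₃ : 0 < γ₃)
    (hp₁ : 1 ≤ p) (hp₂ : p < ((d : ℝ) + 2) / (d : ℝ)) :
    (∃ δ : ℝ, 0 < δ ∧ ∀ u : ℝ × EuclideanSpace ℝ (Fin d) → ℝ,
      DeGiorgiSubclass (-4) 0 (Metric.ball 0 2) γ₁ γ₂ γ₃ p u →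
      (∫⁻ z in parabolicCylinder d 1, ENNReal.ofReal (max (u z) 0 ^ 2)) ≤ ENNReal.ofReal δ →
      ∀ᵐ z ∂(volume.restrict (parabolicCylinder d (1 / 2))), max (u z) 0 ≤ 1 / 2) ∧
    (∃ C : ℝ, 0 < C ∧ ∀ u : ℝ × EuclideanSpace ℝ (Fin d) → ℝ,
      DeGiorgiSubclass (-4) 0 (Metric.ball 0 2) γ₁ γ₂ γ₃ p u →
      eLpNorm (fun z => max (u z) 0) ∞ (volume.restrict (parabolicCylinder d (1 / 2))) ≤
        ENNReal.ofReal C *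
          (eLpNorm (fun z => max (u z) 0) 2 (volume.restrict (parabolicCylinder d 1)) + 1)) := by
  obtain ⟨δ, hδ, H⟩ := exists_positivePart_le_half hd hγ₁ hγ₂ hγ₃ hp₁ hp₂
  exact ⟨⟨δ, hδ, H⟩, 1 + 1 / √δ, by positivity, fun u hu => eLpNorm_top_le_of_smallness hp₁ hδ H hu⟩
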